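/- Let $d\ge 1$, let $\{|a_i\rangle\}_{i=1}^d$, $\{|b_i\rangle\}_{i=1}^d$ be orthonormal bases of $\mathbb C^d$ (systems $A$ and $B$), and let $\rho_{\rm mc}=\sum_{i,j}\rho_{ij}\,|a_ib_i\rangle\langle a_jb_j|$ be a density matrix (a maximally correlated state). Fix an orthonormal basis $\{|i\rangle\}_{i=1}^d$ of $\mathbb C^d$, let $\widetilde{\rho}_{\rm mc}=\sum_{i,j}\rho_{ij}\,|i\rangle\langle j|$ be the corresponding single-party state, let $\mathcal I=\mathrm{conv}\{|i\rangle\langle i|\}_i$ be the set of incoherent (diagonal) states, and let $\Delta(X)=\sum_i |i\rangle\langle i|X|i\rangle\langle i|$. Write $\langle X,Y\rangle=\mathrm{Tr}(X^\dagger Y)$, let $X^{T_B}$ be the partial transpose, and let $\Psi_m$ be the projector onto $\frac1{\sqrt m}\sum_{i=1}^m|ii\rangle$. Let $\mathcal O$ be any one of the following four classes of completely positive trace-preserving maps $\Lambda:AB\to A'B'$: PPT operations (the Choi matrix satisfies $J_\Lambda^{T_{BB'}}\succeq 0$); Rains-preserving operations ($\Lambda$ maps $\{X\succeq0:\|X^{T_B}\|_1\le1\}$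 into the corresponding set of $A'B'$); ${\rm PPT}_+$-preserving operations ($\Lambda$ maps $\{X\succeq 0:\mathrm{Tr}X=1,\ X^{T_B}\succeq0\}$ into the corresponding set of $A'B'$); SEPP, the separability-preserving operations ($\Lambda$ maps separable states to separable states). Put $$F_{\mathcal O}(\rho,m)=\sup\{\langle\Lambda(\rho),\Psi_m\rangle:\Lambda\in\mathcal O,\ d_{A'}=d_{B'}=m\},$$ $$G^{(m)}_{\mathcal I}(\rho)=\sup\{\langle\rho,W\rangle:0\preceq W\preceq \mathbb 1,\ W\in\tfrac1m\mathcal I^\circ\},$$ where $\mathcal I^\circ=\{X \text{ Hermitian}:\langle X,Q\rangle\le1\ \ \forall Q\in\mathcal I\}$. Then for every integer $m\ge1$ $$F_{\mathcal O}(\rho_{\rm mc},m)=G^{(m)}_{\mathcal I}(\widetilde\rho_{\rm mc}).$$ Consequently, for every $0\le\varepsilon\le1$, the one-shot distillable entanglement $E^{(1),\varepsilon}_{d,\mathcal O}(\rho)=\log_2\max\{m\ge1:F_{\mathcal O}(\rho,m)\ge1-\varepsilon\}$ (read as $+\infty$ if there is no largest such $m$) satisfies $$E^{(1),\varepsilon}_{d,\mathcal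 O}(\rho_{\rm mc})=\Big\lfloor\min_{\sigma\in\mathcal I}D_H^\varepsilon(\widetilde\rho_{\rm mc}\|\sigma)\Big\rfloor_{\log}=\Big\lfloor-\log_2\min_{\substack{0\preceq W\preceq\mathbb 1\\ \langle\widetilde\rho_{\rm mc},W\rangle\ge1-\varepsilon}}\|\Delta(W)\|_\infty\Big\rfloor_{\log},$$ all minima being attained, where $D_H^\varepsilon(\rho\|X)=-\log_2\min\{\langle M,X\rangle:0\preceq M\preceq\mathbb 1,\ 1-\langle M,\rho\rangle\le\varepsilon\}$, $\lfloor x\rfloor_{\log}=\log_2\lfloor2^x\rfloor$, and $\log_2 0=-\infty$. The last minimum is the value of the semidefinite program of minimising $t\in\mathbb R$ subject to $0\preceq W\preceq\mathbb 1$, $\langle\widetilde\rho_{\rm mc},W\rangle\ge1-\varepsilon$ and $\Delta(W)\preceq t\,\mathbb 1$. -/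

import Mathlib

open scoped Pointwise ComplexOrder

noncomputable section

namespace Distill

/-! ### Linear algebra on finite-dimensional Hilbert spaces

The Hilbert space with computational basis indexed by `n` is `EuclideanSpace ℂ n`, operators on it
are `Matrix n n ℂ`, and a bipartite system `AB` is indexed by `α × β`. -/

section LinearAlgebra

variable {n α β : Type*} [Fintype n] [DecidableEq n]
  [Fintype α] [DecidableEq α] [Fintype β] [DecidableEq β]

/-- The operator `|x⟩⟨y|`. -/
def ketbra (x y : EuclideanSpace ℂ n) : Matrix n n ℂ :=
  Matrix.of fun i j => x i * star (y j)

/-- The product vector `|x⟩ ⊗ |y⟩`. -/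
def tensorKet (x : EuclideanSpace ℂ α) (y : EuclideanSpace ℂ β) : EuclideanSpace ℂ (α × β) :=
  WithLp.toLp 2 fun p => x p.1 * y p.2

/-- The Hilbert–Schmidt inner product `⟨X, Y⟩ = Tr (X† Y)`, which is real for Hermitian `X, Y`. -/
def hs (X Y : Matrix n n ℂ) : ℝ := (X.conjTranspose * Y).trace.re

/-- The trace norm `‖X‖₁ = Tr |X|`. -/
def traceNorm (X : Matrix n n ℂ) : ℝ :=
  open scoped MatrixOrder in (CFC.abs X).trace.re

/-- The operator norm `‖X‖_∞` (on the Euclidean space). -/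
def opNorm (X : Matrix n n ℂ) : ℝ := ‖Matrix.toEuclideanCLM (n := n) (𝕜 := ℂ) X‖

/-- Density matrices. -/
def IsState (ρ : Matrix n n ℂ) : Prop := ρ.PosSemidef ∧ ρ.trace = 1

/-- The operator inequality `0 ⪯ W ⪯ 𝟙`. -/
def IsEffect (W : Matrix n n ℂ) : Prop := W.PosSemidef ∧ (1 - W).PosSemidef

/-- The partial transpose `X ↦ X^{T_B}` on the second tensor factor (computational basis). -/
def partialTranspose (X : Matrix (α × β) (α × β) ℂ) : Matrix (α × β) (α × β) ℂ :=
  Matrix.of fun p q => X (p.1, q.2) (q.1, p.2)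

/-- The polar `Q° = {X Hermitian | ⟨X, Y⟩ ≤ 1 for all Y ∈ Q}`. -/
def polar (Q : Set (Matrix n n ℂ)) : Set (Matrix n n ℂ) :=
  {X | X.IsHermitian ∧ ∀ Y ∈ Q, hs X Y ≤ 1}

/-! ### Sets of operators -/

/-- Separable states: the convex hull of the pure product states. -/
def SEP : Set (Matrix (α × β) (α × β) ℂ) :=
  convexHull ℝ {X | ∃ (x : EuclideanSpace ℂ α) (y : EuclideanSpace ℂ β),
    ‖x‖ = 1 ∧ ‖y‖ = 1 ∧ X = ketbra (tensorKet x y) (tensorKet x y)}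

/-- States with positive partial transpose. -/
def PPTplus : Set (Matrix (α × β) (α × β) ℂ) :=
  {X | X.trace = 1 ∧ X.PosSemidef ∧ (partialTranspose X).PosSemidef}

/-- The Rains set. -/
def Rains : Set (Matrix (α × β) (α × β) ℂ) :=
  {X | X.PosSemidef ∧ traceNorm (partialTranspose X) ≤ 1}

/-- The incoherent states with respect to an orthonormal basis `c`. -/
def incoherent (c : OrthonormalBasis n ℂ (EuclideanSpace ℂ n)) : Set (Matrix n n ℂ) :=
  convexHull ℝ (Set.range fun i => ketbra (c i) (c i))

/-- The completely dephasing map `Δ(X) = ∑ᵢ |cᵢ⟩⟨cᵢ| X |cᵢ⟩⟨cᵢ|` in the basis `c`. -/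
def dephase (c : OrthonormalBasis n ℂ (EuclideanSpace ℂ n)) (X : Matrix n n ℂ) :
    Matrix n n ℂ :=
  ∑ i, ketbra (c i) (c i) * X * ketbra (c i) (c i)

/-- `∑ᵢⱼ rᵢⱼ |aᵢ bᵢ⟩⟨aⱼ bⱼ|` for local orthonormal bases `a` and `b`. -/
def maxCorr (a b : OrthonormalBasis n ℂ (EuclideanSpace ℂ n)) (r : Matrix n n ℂ) :
    Matrix (n × n) (n × n) ℂ :=
  ∑ i, ∑ j, r i j • ketbra (tensorKet (a i) (b i)) (tensorKet (a j) (b j))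

/-- `∑ᵢⱼ rᵢⱼ |cᵢ⟩⟨cⱼ|` for an orthonormal basis `c`. -/
def singleParty (c : OrthonormalBasis n ℂ (EuclideanSpace ℂ n)) (r : Matrix n n ℂ) :
    Matrix n n ℂ :=
  ∑ i, ∑ j, r i j • ketbra (c i) (c j)

end LinearAlgebra

/-! ### Quantum channels and classes of channels -/

section Channels

/-- Linear maps from operators on the space indexed by `ι` to operators on the one indexed
by `κ`. -/
abbrev OpMap (ι κ : Type*) := Matrix ι ι ℂ →ₗ[ℂ] Matrix κ κ ℂ

variable {ι κ : Type*} [Fintype ι] [Fintype κ]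

/-- The map `Λ ⊗ id` where `id` acts on operators on `ℂᵏ`. -/
def ampliation (Λ : OpMap ι κ) (k : ℕ) (X : Matrix (ι × Fin k) (ι × Fin k) ℂ) :
    Matrix (κ × Fin k) (κ × Fin k) ℂ :=
  Matrix.of fun p q => Λ (Matrix.of fun i j => X (i, p.2) (j, q.2)) p.1 q.1

/-- Completely positive and trace preserving maps. -/
def IsCPTP (Λ : OpMap ι κ) : Prop :=
  (∀ (k : ℕ) (X : Matrix (ι × Fin k) (ι × Fin k) ℂ),
    X.PosSemidef → (ampliation Λ k X).PosSemidef) ∧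
  ∀ X, (Λ X).trace = X.trace

variable {α β α' β' : Type*} [Fintype α] [DecidableEq α] [Fintype β] [DecidableEq β]
  [Fintype α'] [DecidableEq α'] [Fintype β'] [DecidableEq β']

/-- The Choi matrix `∑ |x⟩⟨y| ⊗ Λ(|x⟩⟨y|)` of `Λ : AB → A'B'`, with the tensor factors arranged
along the bipartition `AA' | BB'`. -/
def choi (Λ : OpMap (α × β) (α' × β')) :
    Matrix ((α × α') × (β × β')) ((α × α') × (β × β')) ℂ :=
  Matrix.of fun p q =>
    Λ (Matrix.single (p.1.1, p.2.1) (q.1.1, q.2.1) 1) (p.1.2, p.2.2) (q.1.2, q.2.2)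

/-- The four classes of operations under consideration. -/
inductive OpClass
  | PPT
  | RainsPreserving
  | PPTplusPreserving
  | SEPP

/-- The channels `Λ : AB → A'B'` in a given class. -/
def OpClass.channels (O : OpClass) : Set (OpMap (α × β) (α' × β')) :=
  match O with
  | .PPT => {Λ | IsCPTP Λ ∧ (partialTranspose (choi Λ)).PosSemidef}
  | .RainsPreserving => {Λ | IsCPTP Λ ∧ ∀ X ∈ Rains, Λ X ∈ Rains}
  | .PPTplusPreserving => {Λ | IsCPTP Λ ∧ ∀ X ∈ PPTplus, Λ X ∈ PPTplus}
  | .SEPP => {Λ | IsCPTP Λ ∧ ∀ X ∈ SEP, Λ X ∈ SEP}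

end Channels

/-! ### Operational quantities

All optimal values live in the extended reals, so that every supremum and infimum has its usual
meaning (with `sup ∅ = -∞` and `inf ∅ = +∞`). -/

section Quantities

/-- Base-2 logarithm on the extended reals, with `log x = -∞` for `x ≤ 0`. -/
def elog (x : EReal) : EReal :=
  if x ≤ 0 then ⊥ else if x = ⊤ then ⊤ else ((Real.logb 2 x.toReal : ℝ) : EReal)

/-- `⌊x⌋_log = log ⌊2 ^ x⌋`, with `2 ^ (-∞) = 0` and `2 ^ (+∞) = +∞`. -/
def logFloor (x : EReal) : EReal :=
  if x = ⊥ then ⊥ else if x = ⊤ then ⊤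
  else elog (((⌊(2 : ℝ) ^ x.toReal⌋ : ℝ)) : EReal)

variable {n α β : Type*} [Fintype n] [DecidableEq n]
  [Fintype α] [DecidableEq α] [Fintype β] [DecidableEq β]

/-- `G^{(m)}_Q(ρ) = sup {⟨ρ, W⟩ | 0 ⪯ W ⪯ 𝟙, W ∈ (1/m) Q°}`. -/
def G (m : ℝ) (Q : Set (Matrix n n ℂ)) (ρ : Matrix n n ℂ) : EReal :=
  ⨆ W ∈ {W : Matrix n n ℂ | IsEffect W ∧ W ∈ (1 / m) • polar Q}, ((hs ρ W : ℝ) : EReal)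

/-- The vector `|Ψ_m⟩ = ∑ᵢ |ii⟩ / √m`. -/
def maxEntKet (m : ℕ) : EuclideanSpace ℂ (Fin m × Fin m) :=
  ∑ i : Fin m, (1 / (Real.sqrt m : ℂ)) •
    tensorKet (EuclideanSpace.single i (1 : ℂ)) (EuclideanSpace.single i (1 : ℂ))

/-- The maximally entangled state `Ψ_m`. -/
def maxEnt (m : ℕ) : Matrix (Fin m × Fin m) (Fin m × Fin m) ℂ :=
  ketbra (maxEntKet m) (maxEntKet m)

/-- The fidelity of distillation `F_O(ρ, m)`: the supremum of `⟨Λ(ρ), Ψ_m⟩` over all `Λ ∈ O`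
with output system `ℂᵐ ⊗ ℂᵐ`. -/
def fidelity (O : OpClass) (ρ : Matrix (α × β) (α × β) ℂ) (m : ℕ) : EReal :=
  ⨆ Λ ∈ (O.channels : Set (OpMap (α × β) (Fin m × Fin m))), ((hs (Λ ρ) (maxEnt m) : ℝ) : EReal)

/-- The one-shot `ε`-error distillable entanglement
`log max {m ≥ 1 | F_O(ρ, m) ≥ 1 - ε}` (`+∞` if there is no largest such `m`). -/
def distillable (O : OpClass) (ε : ℝ) (ρ : Matrix (α × β) (α × β) ℂ) : EReal :=
  ⨆ m ∈ {m : ℕ | 1 ≤ m ∧ ((1 - ε : ℝ) : EReal) ≤ fidelity O ρ m}, elog ((m : ℝ) : EReal)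

/-- The hypothesis testing relative entropy
`D_H^ε(ρ‖X) = -log min {⟨M, X⟩ | 0 ⪯ M ⪯ 𝟙, 1 - ⟨M, ρ⟩ ≤ ε}`. -/
def DH (ε : ℝ) (ρ X : Matrix n n ℂ) : EReal :=
  -elog (⨅ M ∈ {M : Matrix n n ℂ | IsEffect M ∧ 1 - hs M ρ ≤ ε}, ((hs M X : ℝ) : EReal))

end Quantities

end Distill

end

/-!
Maximally correlated operators are the operators `V r V†` for the isometry `V |i⟩ = |aᵢ bᵢ⟩`, and
both sides of the fidelity formula equal the supremum of `⟨r, A⟩` over the effects `A` whose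
diagonal entries are at most `1 / m`.

Upper bound: if `Λ†` is the Heisenberg dual of a channel, the compression `A = V† Λ†(Ψ_m) V` is an
effect, and `Aᵢᵢ` is the fidelity of the image of the product state `|aᵢ bᵢ⟩` with `Ψ_m`. All four
classes send separable states into the Rains set, where this fidelity is at most `1 / m` because
`m Ψ_m^{T_B}` is the swap operator, which lies between `-𝟙` and `𝟙`.

Achievability: measure the effect `M = V A V†` and prepare `Ψ_m` on success. Positivity bounds every
entry of `A` by `1 / m`, and `M^{T_B}` is, up to local unitaries, a swap weighted by these entries;
hence `-𝟙 ⪯ m M^{T_B} ⪯ 𝟙`. Preparing `(𝟙 - Ψ_m) / (m² - 1)` on failure then gives a PPT operation.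
It need not preserve separability, so for that class the failure state is the uniform mixture of the
`|ij⟩`, `i ≠ j`: product states are accepted with probability at most `1 / m`, and the
mixtures of `Ψ_m` and this state with weight at most `1 / m` on `Ψ_m` are separable.

The formula for the distillable entanglement follows from Sion's minimax theorem for the bilinear
pairing `∑ᵢ pᵢ Aᵢᵢ` of probability vectors and the effects `A` that accept `r` with probability at
least `1 - ε`.
-/

namespace Distill

open Matrix
open scoped Kronecker

/-! ### Positive semidefinite matrices -/

section PosSemidef

variable {ι κ : Type*}

theorem posSemidef_two_inv_smul {𝕜 : Type*} [RCLike 𝕜] {A : Matrix ι ι 𝕜}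
    (hA : ((2 : ℝ) • A).PosSemidef) : A.PosSemidef := by
  simpa only [inv_smul_smul₀ (two_ne_zero' ℝ)] using hA.smul (show (0 : ℝ) ≤ 2⁻¹ by norm_num)

theorem norm_apply_sq_le {A : Matrix ι ι ℂ} (hA : A.PosSemidef) (i j : ι) :
    ‖A i j‖ ^ 2 ≤ (A i i).re * (A j j).re := by
  have hdet := (Complex.nonneg_iff.mp (hA.submatrix ![i, j]).det_nonneg).1
  have hji : A j i = star (A i j) := (hA.1.apply j i).symm
  have him : (A i i).im = 0 := (Complex.nonneg_iff.mp hA.diag_nonneg).2.symm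
  simp only [det_fin_two, submatrix_apply, cons_val_zero, cons_val_one, hji, Complex.star_def,
    Complex.mul_conj, Complex.sub_re, Complex.mul_re, Complex.ofReal_re,
    Complex.normSq_eq_norm_sq, him, zero_mul, sub_zero] at hdet
  linarith

theorem norm_apply_le_of_diag_le {A : Matrix ι ι ℂ} (hA : A.PosSemidef) {t : ℝ}
    (ht : ∀ i, (A i i).re ≤ t) (i j : ι) : ‖A i j‖ ≤ t := by
  have hdiag (k : ι) : 0 ≤ (A k k).re := (Complex.nonneg_iff.mp hA.diag_nonneg).1
  have ht₀ : 0 ≤ t := (hdiag i).trans (ht i)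
  refine (sq_le_sq₀ (norm_nonneg _) ht₀).mp ?_
  calc ‖A i j‖ ^ 2 ≤ (A i i).re * (A j j).re := norm_apply_sq_le hA i j
    _ ≤ t * t := mul_le_mul (ht i) (ht j) (hdiag j) ht₀
    _ = t ^ 2 := (sq t).symm

variable [Fintype ι]

theorem trace_mul_nonneg {𝕜 : Type*} [RCLike 𝕜] {A B : Matrix ι ι 𝕜} (hA : A.PosSemidef)
    (hB : B.PosSemidef) : 0 ≤ (A * B).trace := by
  classical
  open scoped MatrixOrder in
  obtain ⟨K, rfl⟩ := CStarAlgebra.nonneg_iff_eq_star_mul_self.mp hA.nonneg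
  rw [star_eq_conjTranspose, Matrix.mul_assoc, trace_mul_comm]
  exact (hB.mul_mul_conjTranspose_same K).trace_nonneg

theorem trace_mul_re_nonneg {A B : Matrix ι ι ℂ} (hA : A.PosSemidef) (hB : B.PosSemidef) :
    0 ≤ (A * B).trace.re :=
  (Complex.nonneg_iff.mp (trace_mul_nonneg hA hB)).1

theorem posSemidef_of_forall_trace_mul_nonneg {A : Matrix ι ι ℂ}
    (h : ∀ X : Matrix ι ι ℂ, X.PosSemidef → 0 ≤ (X * A).trace) : A.PosSemidef := by
  classical
  rw [← isPositive_toEuclideanLin_iff, LinearMap.isPositive_iff_complex]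
  intro v
  have hv : 0 ≤ inner ℂ (A.toEuclideanLin v) v := by
    have := h _ (posSemidef_vecMulVec_self_star (v.ofLp))
    rw [vecMulVec_mul, trace_vecMulVec, dotProduct_comm, ← dotProduct_mulVec] at this
    rw [← inner_conj_symm, EuclideanSpace.inner_eq_star_dotProduct, dotProduct_comm]
    exact star_nonneg_iff.mpr this
  obtain ⟨hre, him⟩ := Complex.nonneg_iff.mp hv
  exact ⟨Complex.ext rfl him, hre⟩

theorem posSemidef_one_add_of_mul_self_le_one {𝕜 : Type*} [RCLike 𝕜] [DecidableEq ι]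
    {H : Matrix ι ι 𝕜} (hH : H.IsHermitian) (hsq : (1 - H * H).PosSemidef) :
    (1 + H).PosSemidef := by
  refine posSemidef_two_inv_smul ?_
  have hherm : (1 + H)ᴴ = 1 + H := (isHermitian_one.add hH).eq
  have hdecomp : (2 : ℝ) • (1 + H) = (1 + H)ᴴ * (1 + H) + (1 - H * H) := by
    rw [hherm, two_smul]
    noncomm_ring
  exact hdecomp ▸ (posSemidef_conjTranspose_mul_self _).add hsq

/-- The contraction `∑ₓᵧ Yₓᵧ J₍ₓ,₎₍ᵧ,₎` of the first tensor factor of `J` against `Y`; for the Choi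
matrix `J` of a linear map this is the value of the map at `Y`. -/
def contractLeft (Y : Matrix ι ι ℂ) (J : Matrix (ι × κ) (ι × κ) ℂ) : Matrix κ κ ℂ :=
  of fun u v => ∑ x, ∑ y, Y x y * J (x, u) (y, v)

theorem posSemidef_contractLeft [Finite κ] {Y : Matrix ι ι ℂ} {J : Matrix (ι × κ) (ι × κ) ℂ}
    (hY : Y.PosSemidef) (hJ : J.PosSemidef) : (contractLeft Y J).PosSemidef := by
  classical
  have := Fintype.ofFinite κ
  have hmul := ((hY.submatrix Prod.fst).hadamard hJ).conjTranspose_mul_mul_same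
    ((1 : Matrix κ κ ℂ).submatrix (Prod.snd : ι × κ → κ) id)
  convert! hmul using 1
  ext u v
  simp only [contractLeft, of_apply, mul_apply, conjTranspose_apply, Fintype.sum_prod_type,
    hadamard_apply, submatrix_apply, one_apply, id, apply_ite star, star_one, star_zero, ite_mul,
    one_mul, zero_mul, mul_ite, mul_one, mul_zero, Finset.sum_ite_eq', Finset.mem_univ, if_true]
  rw [Finset.sum_comm]

end PosSemidef

/-! ### Trace norm duality -/

section TraceNorm

open scoped MatrixOrder

variable {ι : Type*} [Fintype ι] [DecidableEq ι]

theorem traceNorm_of_posSemidef {X : Matrix ι ι ℂ} (hX : X.PosSemidef) :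
    traceNorm X = X.trace.re := by
  rw [traceNorm, CFC.abs_of_nonneg X hX.nonneg]

theorem trace_mul_re_le_traceNorm {X S : Matrix ι ι ℂ} (hX : X.IsHermitian)
    (hS₁ : (1 - S).PosSemidef) (hS₂ : (1 + S).PosSemidef) : (X * S).trace.re ≤ traceNorm X := by
  have hpos := trace_mul_re_nonneg (CFC.posPart_nonneg X).posSemidef hS₁
  have hneg := trace_mul_re_nonneg (CFC.negPart_nonneg X).posSemidef hS₂
  rw [Matrix.mul_sub, Matrix.mul_one, trace_sub, Complex.sub_re] at hpos
  rw [Matrix.mul_add, Matrix.mul_one, trace_add, Complex.add_re] at hneg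
  have hsplit : (X * S).trace.re = (X⁺ * S).trace.re - (X⁻ * S).trace.re := by
    conv_lhs => rw [← CFC.posPart_sub_negPart X hX.isSelfAdjoint]
    rw [Matrix.sub_mul, trace_sub, Complex.sub_re]
  have hnorm : traceNorm X = X⁺.trace.re + X⁻.trace.re := by
    rw [traceNorm, ← CFC.posPart_add_negPart X hX.isSelfAdjoint, trace_add, Complex.add_re]
  linarith

theorem exists_traceNorm_eq_trace_mul {X : Matrix ι ι ℂ} (hX : X.IsHermitian) :
    ∃ S : Matrix ι ι ℂ, (1 - S).PosSemidef ∧ (1 + S).PosSemidef ∧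
      traceNorm X = (X * S).trace.re := by
  have hcont (f : ℝ → ℝ) : ContinuousOn f (spectrum ℝ X) :=
    finite_real_spectrum.continuousOn f
  let sgn : ℝ → ℝ := fun x => SignType.sign x
  have hsgn (x : ℝ) : |sgn x| ≤ 1 := by
    rcases lt_trichotomy x 0 with h | rfl | h <;> simp [sgn, *]
  refine ⟨cfc sgn X, Matrix.le_iff.mp (cfc_le_one sgn X fun x _ => (abs_le.mp (hsgn x)).2), ?_, ?_⟩
  · rw [← sub_neg_eq_add, ← cfc_neg]
    exact Matrix.le_iff.mp (cfc_le_one _ X fun x _ => neg_le.mp (abs_le.mp (hsgn x)).1)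
  · rw [traceNorm, CFC.abs_eq_cfc_norm X hX.isSelfAdjoint]
    conv_rhs => enter [1, 1, 1]; rw [← cfc_id ℝ X hX.isSelfAdjoint]
    rw [← cfc_mul id sgn X (hcont _) (hcont _)]
    simp only [id, sgn, self_mul_sign, Real.norm_eq_abs]

end TraceNorm

/-! ### Positive maps and their duals -/

section PositiveMaps

variable {ι κ : Type*}

theorem isHermitian_map [Finite ι] {Φ : OpMap ι κ}
    (hΦ : ∀ X : Matrix ι ι ℂ, X.PosSemidef → (Φ X).PosSemidef) {X : Matrix ι ι ℂ}
    (hX : X.IsHermitian) : (Φ X).IsHermitian := by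
  classical
  have := Fintype.ofFinite ι
  open scoped MatrixOrder in
  rw [← CFC.posPart_sub_negPart X hX.isSelfAdjoint, map_sub]
  exact (hΦ _ (CFC.posPart_nonneg X).posSemidef).1.sub (hΦ _ (CFC.negPart_nonneg X).posSemidef).1

variable [DecidableEq ι]

/-- The Choi matrix `∑ |x⟩⟨y| ⊗ Φ(|x⟩⟨y|)`, with the input factor first. -/
def choiMatrix (Φ : OpMap ι κ) : Matrix (ι × κ) (ι × κ) ℂ :=
  of fun p q => Φ (single p.1 q.1 1) p.2 q.2

theorem map_eq_sum_smul_single [Fintype ι] (Φ : OpMap ι κ) (X : Matrix ι ι ℂ) :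
    Φ X = ∑ i, ∑ j, X i j • Φ (single i j 1) := by
  conv_lhs => rw [matrix_eq_sum_single X]
  simp only [map_sum, ← map_smul, smul_single, smul_eq_mul, mul_one]

theorem map_eq_contractLeft_choiMatrix [Fintype ι] (Φ : OpMap ι κ) (Y : Matrix ι ι ℂ) :
    Φ Y = contractLeft Y (choiMatrix Φ) := by
  ext u v
  rw [map_eq_sum_smul_single]
  simp only [contractLeft, choiMatrix, of_apply, Matrix.sum_apply, Matrix.smul_apply, smul_eq_mul]

theorem posSemidef_map_of_posSemidef_choiMatrix [Finite ι] [Finite κ] {Φ : OpMap ι κ}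
    (hΦ : (choiMatrix Φ).PosSemidef) {Y : Matrix ι ι ℂ} (hY : Y.PosSemidef) :
    (Φ Y).PosSemidef := by
  have := Fintype.ofFinite ι
  exact map_eq_contractLeft_choiMatrix Φ Y ▸ posSemidef_contractLeft hY hΦ

variable [Fintype κ]

/-- The Heisenberg picture of `Φ`: its dual for the trace pairing `(X, E) ↦ Tr (X E)`. -/
def heisenbergDual (Φ : OpMap ι κ) : OpMap κ ι where
  toFun E := of fun j i => (Φ (single i j 1) * E).trace
  map_add' E F := by ext; simp only [Matrix.mul_add, trace_add, of_apply, Matrix.add_apply]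
  map_smul' c E := by
    ext
    simp only [Matrix.mul_smul, trace_smul, of_apply, Matrix.smul_apply, RingHom.id_apply]

theorem trace_mul_heisenbergDual [Fintype ι] (Φ : OpMap ι κ) (X : Matrix ι ι ℂ) (E : Matrix κ κ ℂ) :
    (X * heisenbergDual Φ E).trace = (Φ X * E).trace := by
  rw [map_eq_sum_smul_single Φ X]
  simp only [Matrix.sum_mul, trace_sum, smul_mul, trace_smul, smul_eq_mul]
  simp only [trace, diag_apply, mul_apply, heisenbergDual, LinearMap.coe_mk, AddHom.coe_mk,
    of_apply]

theorem posSemidef_heisenbergDual [Finite ι] {Φ : OpMap ι κ}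
    (hΦ : ∀ X : Matrix ι ι ℂ, X.PosSemidef → (Φ X).PosSemidef) {E : Matrix κ κ ℂ}
    (hE : E.PosSemidef) : (heisenbergDual Φ E).PosSemidef := by
  have := Fintype.ofFinite ι
  exact posSemidef_of_forall_trace_mul_nonneg fun X hX =>
    trace_mul_heisenbergDual Φ X E ▸ trace_mul_nonneg (hΦ X hX) hE

variable [Fintype ι]

theorem heisenbergDual_one [DecidableEq κ] {Φ : OpMap ι κ}
    (hΦ : ∀ X, (Φ X).trace = X.trace) : heisenbergDual Φ 1 = 1 := by
  ext i j
  simp only [heisenbergDual, LinearMap.coe_mk, AddHom.coe_mk, of_apply, Matrix.mul_one, hΦ,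
    one_apply]
  split_ifs with hij
  · rw [hij, trace_single_eq_same]
  · rw [trace_single_eq_of_ne _ _ _ (Ne.symm hij)]

theorem traceNorm_map_le [DecidableEq κ] {Φ : OpMap ι κ}
    (hΦ : ∀ X : Matrix ι ι ℂ, X.PosSemidef → (Φ X).PosSemidef)
    (htr : ∀ X, (Φ X).trace = X.trace) {X : Matrix ι ι ℂ} (hX : X.IsHermitian) :
    traceNorm (Φ X) ≤ traceNorm X := by
  obtain ⟨S, hS₁, hS₂, hS⟩ := exists_traceNorm_eq_trace_mul (isHermitian_map hΦ hX)
  rw [hS, ← trace_mul_heisenbergDual]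
  apply trace_mul_re_le_traceNorm hX
  · rw [← heisenbergDual_one htr, ← map_sub]
    exact posSemidef_heisenbergDual hΦ hS₁
  · rw [← heisenbergDual_one htr, ← map_add]
    exact posSemidef_heisenbergDual hΦ hS₂

theorem isEffect_heisenbergDual [DecidableEq κ] {Φ : OpMap ι κ}
    (hΦ : ∀ X : Matrix ι ι ℂ, X.PosSemidef → (Φ X).PosSemidef)
    (htr : ∀ X, (Φ X).trace = X.trace) {E : Matrix κ κ ℂ} (hE : IsEffect E) :
    IsEffect (heisenbergDual Φ E) := by
  refine ⟨posSemidef_heisenbergDual hΦ hE.1, ?_⟩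
  rw [← heisenbergDual_one htr, ← map_sub]
  exact posSemidef_heisenbergDual hΦ hE.2

end PositiveMaps

/-! ### Effects -/

section Effects

variable {ι κ : Type*} [DecidableEq ι] [DecidableEq κ]

theorem isEffect_zero : IsEffect (0 : Matrix ι ι ℂ) :=
  ⟨PosSemidef.zero, (sub_zero (1 : Matrix ι ι ℂ)).symm ▸ PosSemidef.one⟩

theorem isEffect_one : IsEffect (1 : Matrix ι ι ℂ) :=
  ⟨PosSemidef.one, (sub_self (1 : Matrix ι ι ℂ)).symm ▸ PosSemidef.zero⟩

open scoped MatrixOrder in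
theorem setOf_isEffect : {A : Matrix ι ι ℂ | IsEffect A} = Set.Icc 0 1 :=
  Set.ext fun _ => and_congr Matrix.nonneg_iff_posSemidef.symm Matrix.le_iff.symm

variable [Fintype κ]

theorem isEffect_of_isStarProjection {P : Matrix κ κ ℂ} (hP : IsStarProjection P) :
    IsEffect P := by
  open scoped MatrixOrder in
  exact ⟨hP.nonneg.posSemidef, hP.one_sub.nonneg.posSemidef⟩

theorem IsEffect.compress [Finite ι] {W : Matrix κ κ ℂ} (hW : IsEffect W) {V : Matrix κ ι ℂ}
    (hV : Vᴴ * V = 1) : IsEffect (Vᴴ * W * V) := by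
  have := Fintype.ofFinite ι
  refine ⟨hW.1.conjTranspose_mul_mul_same V, ?_⟩
  have hcompl : 1 - Vᴴ * W * V = Vᴴ * (1 - W) * V := by
    rw [Matrix.mul_sub, Matrix.sub_mul, Matrix.mul_one, hV]
  exact hcompl ▸ hW.2.conjTranspose_mul_mul_same V

theorem IsEffect.dilate [Fintype ι] {W : Matrix ι ι ℂ} (hW : IsEffect W) {V : Matrix κ ι ℂ}
    (hV : Vᴴ * V = 1) : IsEffect (V * W * Vᴴ) := by
  refine ⟨hW.1.mul_mul_conjTranspose_same V, ?_⟩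
  have hproj : IsEffect (V * Vᴴ) := isEffect_of_isStarProjection
    ⟨by rw [IsIdempotentElem, Matrix.mul_assoc, ← Matrix.mul_assoc Vᴴ, hV, Matrix.one_mul],
      isHermitian_mul_conjTranspose_self V⟩
  have hcompl : 1 - V * W * Vᴴ = (1 - V * Vᴴ) + V * (1 - W) * Vᴴ := by
    rw [Matrix.mul_sub, Matrix.sub_mul, Matrix.mul_one, sub_add_sub_cancel]
  exact hcompl ▸ hproj.2.add (hW.2.mul_mul_conjTranspose_same V)

end Effects

/-! ### Rank-one operators and orthonormal families -/

section Ketbra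

variable {ι κ α β : Type*}

theorem posSemidef_ketbra [Finite κ] (x : EuclideanSpace ℂ κ) : (ketbra x x).PosSemidef :=
  posSemidef_vecMulVec_self_star x.ofLp

/-- The matrix whose columns are the vectors of the family `u`. -/
def columnMatrix (u : ι → EuclideanSpace ℂ κ) : Matrix κ ι ℂ :=
  of fun x i => u i x

section

variable [Fintype κ]

theorem trace_ketbra (x y : EuclideanSpace ℂ κ) : (ketbra x y).trace = inner ℂ y x := by
  rw [EuclideanSpace.inner_eq_star_dotProduct]
  exact trace_vecMulVec _ _

theorem conjTranspose_columnMatrix_mul_self [DecidableEq ι] {u : ι → EuclideanSpace ℂ κ}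
    (hu : Orthonormal ℂ u) : (columnMatrix u)ᴴ * columnMatrix u = 1 := by
  ext i j
  rw [one_apply, ← orthonormal_iff_ite.mp hu i j, EuclideanSpace.inner_eq_star_dotProduct,
    dotProduct_comm]
  rfl

theorem columnMatrix_mem_unitaryGroup [DecidableEq κ]
    (c : OrthonormalBasis κ ℂ (EuclideanSpace ℂ κ)) : columnMatrix c ∈ unitaryGroup κ ℂ :=
  mem_unitaryGroup_iff'.mpr (conjTranspose_columnMatrix_mul_self c.orthonormal)

end

theorem sum_smul_ketbra [Fintype ι] (u : ι → EuclideanSpace ℂ κ) (r : Matrix ι ι ℂ) :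
    ∑ i, ∑ j, r i j • ketbra (u i) (u j) = columnMatrix u * r * (columnMatrix u)ᴴ := by
  ext x y
  simp only [Matrix.sum_apply, Matrix.smul_apply, ketbra, of_apply, mul_apply, columnMatrix,
    conjTranspose_apply, smul_eq_mul, Finset.sum_mul]
  rw [Finset.sum_comm]
  exact Finset.sum_congr rfl fun _ _ => Finset.sum_congr rfl fun _ _ => by ring

theorem inner_tensorKet [Fintype α] [Fintype β] (x x' : EuclideanSpace ℂ α)
    (y y' : EuclideanSpace ℂ β) :
    inner ℂ (tensorKet x y) (tensorKet x' y') = inner ℂ x x' * inner ℂ y y' := by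
  simp only [PiLp.inner_apply, tensorKet, Fintype.sum_prod_type, Finset.sum_mul_sum,
    RCLike.inner_apply, map_mul]
  exact Finset.sum_congr rfl fun _ _ => Finset.sum_congr rfl fun _ _ => by ring

theorem orthonormal_tensorKet [Fintype α] [Fintype β]
    {u : ι → EuclideanSpace ℂ α} {v : ι → EuclideanSpace ℂ β} (hu : Orthonormal ℂ u)
    (hv : Orthonormal ℂ v) : Orthonormal ℂ fun i => tensorKet (u i) (v i) := by
  classical
  rw [orthonormal_iff_ite] at *
  intro i j
  rw [inner_tensorKet, hu, hv]
  split_ifs <;> simp only [mul_one, mul_zero]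

end Ketbra

/-! ### The partial transpose -/

section PartialTranspose

variable {α β : Type*}

theorem partialTranspose_apply (X : Matrix (α × β) (α × β) ℂ) (p q : α × β) :
    partialTranspose X p q = X (p.1, q.2) (q.1, p.2) := rfl

theorem partialTranspose_add (X Y : Matrix (α × β) (α × β) ℂ) :
    partialTranspose (X + Y) = partialTranspose X + partialTranspose Y := rfl

theorem partialTranspose_sub (X Y : Matrix (α × β) (α × β) ℂ) :
    partialTranspose (X - Y) = partialTranspose X - partialTranspose Y := rfl

theorem partialTranspose_smul {R : Type*} [SMul R ℂ] (t : R) (X : Matrix (α × β) (α × β) ℂ) :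
    partialTranspose (t • X) = t • partialTranspose X := rfl

theorem isHermitian_partialTranspose {X : Matrix (α × β) (α × β) ℂ} (hX : X.IsHermitian) :
    (partialTranspose X).IsHermitian :=
  IsHermitian.ext fun p q => hX.apply (p.1, q.2) (q.1, p.2)

theorem partialTranspose_ketbra_tensorKet (x x' : EuclideanSpace ℂ α)
    (y y' : EuclideanSpace ℂ β) :
    partialTranspose (ketbra (tensorKet x y) (tensorKet x' y')) =
      ketbra (tensorKet x (WithLp.toLp 2 (star y'.ofLp)))
        (tensorKet x' (WithLp.toLp 2 (star y.ofLp))) := by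
  ext p q
  simp only [partialTranspose_apply, ketbra, tensorKet, of_apply, star_mul', Pi.star_apply,
    star_star]
  ring

section DecidableEq

variable [DecidableEq α] [DecidableEq β]

theorem partialTranspose_single (x y : α × β) (c : ℂ) :
    partialTranspose (single x y c) = single (x.1, y.2) (y.1, x.2) c := by
  ext p q
  simp only [partialTranspose_apply, single_apply, Prod.ext_iff]
  congr 1
  exact propext (by tauto)

theorem partialTranspose_one : partialTranspose (1 : Matrix (α × β) (α × β) ℂ) = 1 := by
  ext p q
  simp only [partialTranspose_apply, one_apply, Prod.ext_iff]
  congr 1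
  exact propext (by tauto)

end DecidableEq

variable [Fintype α] [Fintype β]

theorem trace_partialTranspose (X : Matrix (α × β) (α × β) ℂ) :
    (partialTranspose X).trace = X.trace := rfl

theorem trace_partialTranspose_mul_partialTranspose (X Y : Matrix (α × β) (α × β) ℂ) :
    (partialTranspose X * partialTranspose Y).trace = (X * Y).trace := by
  simp only [trace, diag_apply, mul_apply, ← Fintype.sum_prod_type']
  let e : (α × β) × (α × β) ≃ (α × β) × (α × β) :=
    ⟨fun p => ((p.1.1, p.2.2), (p.2.1, p.1.2)), fun p => ((p.1.1, p.2.2), (p.2.1, p.1.2)),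
      fun _ => rfl, fun _ => rfl⟩
  exact e.sum_comp fun p => X p.1 p.2 * Y p.2 p.1

end PartialTranspose

/-! ### Separable states, PPT states and the Rains set -/

section Sets

variable {α β : Type*} [Fintype α] [Fintype β]

theorem ketbra_tensorKet_mem_SEP {x : EuclideanSpace ℂ α} {y : EuclideanSpace ℂ β}
    (hx : ‖x‖ = 1) (hy : ‖y‖ = 1) : ketbra (tensorKet x y) (tensorKet x y) ∈ SEP :=
  subset_convexHull ℝ _ ⟨x, y, hx, hy, rfl⟩

theorem convex_PPTplus : Convex ℝ (PPTplus : Set (Matrix (α × β) (α × β) ℂ)) := by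
  rintro X ⟨hXtr, hX, hXpt⟩ Y ⟨hYtr, hY, hYpt⟩ s t hs ht hst
  refine ⟨?_, (hX.smul hs).add (hY.smul ht), (hXpt.smul hs).add (hYpt.smul ht)⟩
  rw [trace_add, trace_smul, trace_smul, hXtr, hYtr, ← add_smul, hst, one_smul]

theorem SEP_subset_PPTplus : (SEP : Set (Matrix (α × β) (α × β) ℂ)) ⊆ PPTplus := by
  refine convexHull_min ?_ convex_PPTplus
  rintro _ ⟨x, y, hx, hy, rfl⟩
  refine ⟨?_, posSemidef_ketbra _, partialTranspose_ketbra_tensorKet x x y y ▸ posSemidef_ketbra _⟩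
  rw [trace_ketbra, inner_tensorKet, inner_self_eq_norm_sq_to_K, inner_self_eq_norm_sq_to_K, hx, hy]
  norm_num

theorem isState_of_mem_SEP {X : Matrix (α × β) (α × β) ℂ} (hX : X ∈ SEP) : IsState X :=
  ⟨(SEP_subset_PPTplus hX).2.1, (SEP_subset_PPTplus hX).1⟩

theorem PPTplus_subset_Rains [DecidableEq α] [DecidableEq β] :
    (PPTplus : Set (Matrix (α × β) (α × β) ℂ)) ⊆ Rains := by
  rintro X ⟨htr, hX, hpt⟩
  refine ⟨hX, ?_⟩
  rw [traceNorm_of_posSemidef hpt, trace_partialTranspose, htr, Complex.one_re]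

end Sets

/-! ### Weighted swaps -/

section Swap

variable {ι : Type*} [DecidableEq ι]

/-- The operator `∑ᵢⱼ Wᵢⱼ |ij⟩⟨ji|`, which is the partial transpose of `∑ᵢⱼ Wᵢⱼ |ii⟩⟨jj|`. -/
def swapWeighted (W : Matrix ι ι ℂ) : Matrix (ι × ι) (ι × ι) ℂ :=
  of fun p q => if q = p.swap then W p.1 p.2 else 0

theorem isHermitian_swapWeighted {W : Matrix ι ι ℂ} (hW : W.IsHermitian) :
    (swapWeighted W).IsHermitian := by
  refine IsHermitian.ext fun p q => ?_
  simp only [swapWeighted, of_apply, apply_ite star, star_zero, hW.apply]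
  by_cases h : q = p.swap
  · subst h
    simp only [Prod.swap_swap, if_true, Prod.fst_swap, Prod.snd_swap]
  · rw [if_neg h, if_neg fun h' => h (by rw [h', Prod.swap_swap])]

theorem swapWeighted_neg (W : Matrix ι ι ℂ) : swapWeighted (-W) = -swapWeighted W := by
  ext
  simp only [swapWeighted, Matrix.neg_apply, of_apply, neg_ite, neg_zero]

theorem swapWeighted_mul_swapWeighted [Fintype ι] (V W : Matrix ι ι ℂ) :
    swapWeighted V * swapWeighted W = diagonal fun p => V p.1 p.2 * W p.2 p.1 := by
  ext p q
  simp only [mul_apply, swapWeighted, of_apply, ite_mul, zero_mul]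
  rw [Finset.sum_ite_eq', if_pos (Finset.mem_univ _), Prod.swap_swap, mul_ite, mul_zero,
    diagonal_apply, ite_cond_congr (propext eq_comm), Prod.fst_swap, Prod.snd_swap]

variable [Finite ι]

theorem posSemidef_one_add_swapWeighted {W : Matrix ι ι ℂ} (hW : W.IsHermitian)
    (hnorm : ∀ i j, ‖W i j‖ ≤ 1) : (1 + swapWeighted W).PosSemidef := by
  have := Fintype.ofFinite ι
  refine posSemidef_one_add_of_mul_self_le_one (isHermitian_swapWeighted hW) ?_
  rw [swapWeighted_mul_swapWeighted, ← diagonal_one, diagonal_sub, posSemidef_diagonal_iff]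
  intro p
  rw [← hW.apply p.2 p.1, Complex.star_def, Complex.mul_conj, Complex.normSq_eq_norm_sq,
    sub_nonneg, ← Complex.ofReal_one, Complex.real_le_real]
  exact pow_le_one₀ (norm_nonneg _) (hnorm _ _)

theorem posSemidef_one_sub_swapWeighted {W : Matrix ι ι ℂ} (hW : W.IsHermitian)
    (hnorm : ∀ i j, ‖W i j‖ ≤ 1) : (1 - swapWeighted W).PosSemidef := by
  rw [sub_eq_add_neg, ← swapWeighted_neg]
  exact posSemidef_one_add_swapWeighted hW.neg fun i j => (norm_neg (W i j)).trans_le (hnorm i j)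

/-- The swap operator `∑ᵢⱼ |ij⟩⟨ji|`. -/
def swapOperator (ι : Type*) [DecidableEq ι] : Matrix (ι × ι) (ι × ι) ℂ :=
  swapWeighted (of fun _ _ => 1)

theorem posSemidef_one_add_swapOperator : (1 + swapOperator ι).PosSemidef :=
  posSemidef_one_add_swapWeighted (IsHermitian.ext fun _ _ => star_one ℂ) fun _ _ => norm_one.le

theorem posSemidef_one_sub_swapOperator : (1 - swapOperator ι).PosSemidef :=
  posSemidef_one_sub_swapWeighted (IsHermitian.ext fun _ _ => star_one ℂ) fun _ _ => norm_one.le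

end Swap

/-! ### The maximally entangled state -/

section MaxEnt

theorem maxEntKet_apply (m : ℕ) (p : Fin m × Fin m) :
    maxEntKet m p = if p.1 = p.2 then 1 / (Real.sqrt m : ℂ) else 0 := by
  simp only [maxEntKet, WithLp.ofLp_sum, Finset.sum_apply, WithLp.ofLp_smul, Pi.smul_apply,
    tensorKet, PiLp.single_apply, smul_eq_mul, mul_ite, mul_one, mul_zero,
    Finset.sum_ite_eq, Finset.mem_univ, if_true]

theorem maxEnt_apply (m : ℕ) (p q : Fin m × Fin m) :
    maxEnt m p q = if p.1 = p.2 ∧ q.1 = q.2 then 1 / (m : ℂ) else 0 := by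
  have hsq : (1 / (Real.sqrt m : ℂ)) * star (1 / (Real.sqrt m : ℂ)) = 1 / (m : ℂ) := by
    rw [Complex.star_def, map_div₀, map_one, Complex.conj_ofReal, div_mul_div_comm, one_mul,
      ← Complex.ofReal_mul, Real.mul_self_sqrt (Nat.cast_nonneg m), Complex.ofReal_natCast]
  simp only [maxEnt, ketbra, of_apply, maxEntKet_apply]
  split_ifs <;> simp_all

theorem posSemidef_maxEnt (m : ℕ) : (maxEnt m).PosSemidef := posSemidef_ketbra _

theorem isState_maxEnt {m : ℕ} (hm : m ≠ 0) : IsState (maxEnt m) := by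
  refine ⟨posSemidef_maxEnt m, ?_⟩
  have : (m : ℂ) ≠ 0 := Nat.cast_ne_zero.mpr hm
  simp [trace, maxEnt_apply, Fintype.sum_prod_type, this]

theorem maxEnt_mul_self {m : ℕ} (hm : m ≠ 0) : maxEnt m * maxEnt m = maxEnt m := by
  have : (m : ℂ) ≠ 0 := Nat.cast_ne_zero.mpr hm
  ext p q
  simp only [mul_apply, maxEnt_apply, Fintype.sum_prod_type]
  by_cases hp : p.1 = p.2 <;> by_cases hq : q.1 = q.2 <;> simp [hp, hq, this]

theorem isEffect_maxEnt {m : ℕ} (hm : m ≠ 0) : IsEffect (maxEnt m) :=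
  isEffect_of_isStarProjection ⟨maxEnt_mul_self hm, (posSemidef_maxEnt m).1⟩

theorem partialTranspose_maxEnt (m : ℕ) :
    partialTranspose (maxEnt m) = (1 / (m : ℝ)) • swapOperator (Fin m) := by
  ext p q
  simp only [partialTranspose_apply, maxEnt_apply, Matrix.smul_apply, swapOperator, swapWeighted,
    of_apply, Prod.ext_iff, Prod.fst_swap, Prod.snd_swap, Complex.real_smul, mul_ite, mul_one,
    mul_zero, Complex.ofReal_div, Complex.ofReal_one, Complex.ofReal_natCast]
  exact ite_cond_congr (propext ⟨fun h => ⟨h.2, h.1.symm⟩, fun h => ⟨h.2.symm, h.1⟩⟩)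

theorem hs_eq_trace_mul_re {κ : Type*} [Fintype κ] {X : Matrix κ κ ℂ} (hX : X.IsHermitian)
    (Y : Matrix κ κ ℂ) : hs X Y = (X * Y).trace.re := by
  rw [hs, hX.eq]

theorem hs_maxEnt_le_of_mem_Rains {m : ℕ} {Z : Matrix (Fin m × Fin m) (Fin m × Fin m) ℂ}
    (hZ : Z ∈ Rains) : hs Z (maxEnt m) ≤ 1 / m := by
  have hswap : (partialTranspose Z * swapOperator (Fin m)).trace.re ≤ 1 :=
    (trace_mul_re_le_traceNorm (isHermitian_partialTranspose hZ.1.1)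
      posSemidef_one_sub_swapOperator posSemidef_one_add_swapOperator).trans hZ.2
  calc hs Z (maxEnt m)
      = (partialTranspose Z * partialTranspose (maxEnt m)).trace.re := by
        rw [hs_eq_trace_mul_re hZ.1.1, trace_partialTranspose_mul_partialTranspose]
    _ = 1 / m * (partialTranspose Z * swapOperator (Fin m)).trace.re := by
        rw [partialTranspose_maxEnt, Matrix.mul_smul, trace_smul, Complex.smul_re, smul_eq_mul]
    _ ≤ 1 / m := mul_le_of_le_one_right (by positivity) hswap

end MaxEnt

/-! ### Maximally correlated operators -/

section MaxCorr

variable {n : Type*} [Fintype n] (a b : OrthonormalBasis n ℂ (EuclideanSpace ℂ n))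

/-- The isometry `|i⟩ ↦ |aᵢ bᵢ⟩`. -/
noncomputable def pairIsometry : Matrix (n × n) n ℂ :=
  columnMatrix fun i => tensorKet (a i) (b i)

theorem maxCorr_eq (r : Matrix n n ℂ) :
    maxCorr a b r = pairIsometry a b * r * (pairIsometry a b)ᴴ :=
  sum_smul_ketbra _ r

theorem maxCorr_smul (t : ℝ) (r : Matrix n n ℂ) : maxCorr a b (t • r) = t • maxCorr a b r := by
  rw [maxCorr_eq, maxCorr_eq, Matrix.mul_smul, Matrix.smul_mul]

theorem posSemidef_maxCorr {W : Matrix n n ℂ} (hW : W.PosSemidef) :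
    (maxCorr a b W).PosSemidef :=
  maxCorr_eq a b W ▸ hW.mul_mul_conjTranspose_same _

theorem conjTranspose_pairIsometry_mul_self [DecidableEq n] :
    (pairIsometry a b)ᴴ * pairIsometry a b = 1 :=
  conjTranspose_columnMatrix_mul_self (orthonormal_tensorKet a.orthonormal b.orthonormal)

theorem maxCorr_mul_maxCorr (r W : Matrix n n ℂ) :
    maxCorr a b r * maxCorr a b W = maxCorr a b (r * W) := by
  classical
  simp only [maxCorr_eq, Matrix.mul_assoc]
  rw [← Matrix.mul_assoc _ (pairIsometry a b) (W * _), conjTranspose_pairIsometry_mul_self,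
    Matrix.one_mul]

theorem conjTranspose_mul_maxCorr_mul (r : Matrix n n ℂ) :
    (pairIsometry a b)ᴴ * maxCorr a b r * pairIsometry a b = r := by
  classical
  simp only [maxCorr_eq, Matrix.mul_assoc, conjTranspose_pairIsometry_mul_self, Matrix.mul_one]
  rw [← Matrix.mul_assoc, conjTranspose_pairIsometry_mul_self, Matrix.one_mul]

theorem trace_maxCorr (r : Matrix n n ℂ) : (maxCorr a b r).trace = r.trace := by
  classical
  rw [maxCorr_eq, trace_mul_cycle, conjTranspose_pairIsometry_mul_self, Matrix.one_mul]

theorem isState_maxCorr {r : Matrix n n ℂ} (hr : IsState r) : IsState (maxCorr a b r) :=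
  ⟨posSemidef_maxCorr a b hr.1, (trace_maxCorr a b r).trans hr.2⟩

variable {a b} in
theorem IsState.of_maxCorr {r : Matrix n n ℂ} (h : IsState (maxCorr a b r)) : IsState r := by
  refine ⟨?_, by rw [← trace_maxCorr a b, h.2]⟩
  rw [← conjTranspose_mul_maxCorr_mul a b r]
  exact h.1.conjTranspose_mul_mul_same _

variable [DecidableEq n]

theorem maxCorr_single (i : n) :
    maxCorr a b (single i i 1) = ketbra (tensorKet (a i) (b i)) (tensorKet (a i) (b i)) := by
  simp [maxCorr, single_apply, ite_and]

theorem isEffect_maxCorr {W : Matrix n n ℂ} (hW : IsEffect W) : IsEffect (maxCorr a b W) :=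
  maxCorr_eq a b W ▸ hW.dilate (conjTranspose_pairIsometry_mul_self a b)

theorem partialTranspose_maxCorr (W : Matrix n n ℂ) :
    partialTranspose (maxCorr a b W) = (columnMatrix a ⊗ₖ (columnMatrix b).map star) *
      swapWeighted W * (columnMatrix a ⊗ₖ (columnMatrix b).map star)ᴴ := by
  ext p q
  simp only [partialTranspose_apply, maxCorr, Matrix.sum_apply, Matrix.smul_apply, ketbra, of_apply,
    tensorKet, smul_eq_mul, mul_apply, conjTranspose_apply, swapWeighted, mul_ite, mul_zero,
    ← Prod.swap_eq_iff_eq_swap, Finset.sum_ite_eq, Finset.mem_univ, if_true]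
  rw [Fintype.sum_prod_type, Finset.sum_comm]
  refine Finset.sum_congr rfl fun _ _ => Finset.sum_congr rfl fun _ _ => ?_
  simp only [columnMatrix, kroneckerMap_apply, map_apply, of_apply, Prod.fst_swap, Prod.snd_swap,
    star_mul', star_star]
  ring

theorem kronecker_columnMatrix_mul_conjTranspose :
    (columnMatrix a ⊗ₖ (columnMatrix b).map star) *
      (columnMatrix a ⊗ₖ (columnMatrix b).map star)ᴴ = 1 :=
  mem_unitaryGroup_iff.mp <| kronecker_mem_unitary (columnMatrix_mem_unitaryGroup a)
    (map_star_mem_unitaryGroup_iff.mpr (columnMatrix_mem_unitaryGroup b))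

theorem posSemidef_one_add_partialTranspose_maxCorr {W : Matrix n n ℂ} (hW : W.IsHermitian)
    (hnorm : ∀ i j, ‖W i j‖ ≤ 1) : (1 + partialTranspose (maxCorr a b W)).PosSemidef := by
  have h := (posSemidef_one_add_swapWeighted hW hnorm).mul_mul_conjTranspose_same
    (columnMatrix a ⊗ₖ (columnMatrix b).map star)
  rwa [Matrix.mul_add, Matrix.mul_one, Matrix.add_mul, kronecker_columnMatrix_mul_conjTranspose,
    ← partialTranspose_maxCorr] at h

theorem posSemidef_one_sub_partialTranspose_maxCorr {W : Matrix n n ℂ} (hW : W.IsHermitian)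
    (hnorm : ∀ i j, ‖W i j‖ ≤ 1) : (1 - partialTranspose (maxCorr a b W)).PosSemidef := by
  have h := (posSemidef_one_sub_swapWeighted hW hnorm).mul_mul_conjTranspose_same
    (columnMatrix a ⊗ₖ (columnMatrix b).map star)
  rwa [Matrix.mul_sub, Matrix.mul_one, Matrix.sub_mul, kronecker_columnMatrix_mul_conjTranspose,
    ← partialTranspose_maxCorr] at h

end MaxCorr

/-! ### Measure-and-prepare channels -/

section Channels

variable {ι κ : Type*} [Fintype ι]

theorem IsCPTP.posSemidef_map [Fintype κ] {Λ : OpMap ι κ} (hΛ : IsCPTP Λ) {X : Matrix ι ι ℂ}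
    (hX : X.PosSemidef) : (Λ X).PosSemidef :=
  (hΛ.1 1 _ (hX.submatrix Prod.fst)).submatrix fun u => (u, 0)

variable [DecidableEq ι]

/-- The map that measures the effect `M` and prepares `σ` on success and `τ` on failure. -/
noncomputable def measurePrepare (M : Matrix ι ι ℂ) (σ τ : Matrix κ κ ℂ) : OpMap ι κ where
  toFun X := (X * M).trace • σ + (X * (1 - M)).trace • τ
  map_add' X Y := by
    simp only [Matrix.add_mul, trace_add, add_smul]
    abel
  map_smul' t X := by
    simp only [smul_mul, trace_smul, smul_assoc, smul_add, RingHom.id_apply]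

theorem measurePrepare_apply (M : Matrix ι ι ℂ) (σ τ : Matrix κ κ ℂ) (X : Matrix ι ι ℂ) :
    measurePrepare M σ τ X = (X * M).trace • σ + (X * (1 - M)).trace • τ := rfl

theorem ampliation_measurePrepare (M : Matrix ι ι ℂ) (σ τ : Matrix κ κ ℂ) (k : ℕ)
    (X : Matrix (ι × Fin k) (ι × Fin k) ℂ) :
    ampliation (measurePrepare M σ τ) k X =
      σ ⊗ₖ contractLeft Mᵀ X + τ ⊗ₖ contractLeft (1 - M)ᵀ X := by
  ext p q
  simp only [ampliation, measurePrepare_apply, Matrix.add_apply, Matrix.smul_apply, of_apply,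
    kroneckerMap_apply, smul_eq_mul, trace, diag_apply, mul_apply, transpose_apply, contractLeft,
    mul_comm]

theorem isCPTP_measurePrepare [Fintype κ] {M : Matrix ι ι ℂ} {σ τ : Matrix κ κ ℂ}
    (hM : IsEffect M) (hσ : IsState σ) (hτ : IsState τ) : IsCPTP (measurePrepare M σ τ) := by
  refine ⟨fun k X hX => ?_, fun X => ?_⟩
  · rw [ampliation_measurePrepare]
    exact (hσ.1.kronecker (posSemidef_contractLeft hM.1.transpose hX)).add
      (hτ.1.kronecker (posSemidef_contractLeft hM.2.transpose hX))
  · rw [measurePrepare_apply, trace_add, trace_smul, trace_smul, hσ.2, hτ.2, smul_eq_mul,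
      smul_eq_mul, mul_one, mul_one, ← trace_add, ← Matrix.mul_add, add_sub_cancel, Matrix.mul_one]

end Channels

/-! ### The four classes of operations -/

section Classes

variable {α β α' β' : Type*}

/-- The map `X ↦ (Λ (X^{T_B}))^{T_B'}`, which is completely positive iff `Λ` is a PPT operation. -/
def partialTransposeConj (Λ : OpMap (α × β) (α' × β')) : OpMap (α × β) (α' × β') where
  toFun X := partialTranspose (Λ (partialTranspose X))
  map_add' X Y := by rw [partialTranspose_add, map_add, partialTranspose_add]
  map_smul' t X := by
    rw [partialTranspose_smul, map_smul, partialTranspose_smul, RingHom.id_apply]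

theorem partialTransposeConj_apply (Λ : OpMap (α × β) (α' × β'))
    (X : Matrix (α × β) (α × β) ℂ) :
    partialTransposeConj Λ X = partialTranspose (Λ (partialTranspose X)) := rfl

theorem trace_partialTransposeConj_apply [Fintype α] [Fintype β] [Fintype α'] [Fintype β']
    {Λ : OpMap (α × β) (α' × β')}
    (hΛ : ∀ X, (Λ X).trace = X.trace) (X : Matrix (α × β) (α × β) ℂ) :
    (partialTransposeConj Λ X).trace = X.trace := by
  rw [partialTransposeConj_apply, trace_partialTranspose, hΛ, trace_partialTranspose]

variable [DecidableEq α] [DecidableEq β]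

theorem choiMatrix_partialTransposeConj (Λ : OpMap (α × β) (α' × β')) :
    choiMatrix (partialTransposeConj Λ) =
      (partialTranspose (choi Λ)).submatrix (Equiv.prodProdProdComm α β α' β')
        (Equiv.prodProdProdComm α β α' β') := by
  ext p q
  simp only [choiMatrix, of_apply, partialTransposeConj_apply, partialTranspose_single]
  rfl

theorem posSemidef_partialTransposeConj_apply [Finite α] [Finite β] [Finite α'] [Finite β']
    {Λ : OpMap (α × β) (α' × β')} (hΛ : (partialTranspose (choi Λ)).PosSemidef)
    {Y : Matrix (α × β) (α × β) ℂ} (hY : Y.PosSemidef) : (partialTransposeConj Λ Y).PosSemidef := by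
  refine posSemidef_map_of_posSemidef_choiMatrix ?_ hY
  rw [choiMatrix_partialTransposeConj]
  exact hΛ.submatrix _

variable [Fintype α] [Fintype β]

theorem partialTranspose_choi_measurePrepare (M : Matrix (α × β) (α × β) ℂ)
    (σ τ : Matrix (α' × β') (α' × β') ℂ) :
    partialTranspose (choi (measurePrepare M σ τ)) =
      ((partialTranspose M)ᵀ ⊗ₖ partialTranspose σ +
        (1 - partialTranspose M)ᵀ ⊗ₖ partialTranspose τ).submatrix
        (Equiv.prodProdProdComm α α' β β') (Equiv.prodProdProdComm α α' β β') := by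
  rw [← partialTranspose_one, ← partialTranspose_sub]
  ext p q
  simp only [partialTranspose_apply, choi, of_apply, measurePrepare_apply, Matrix.add_apply,
    Matrix.smul_apply, trace_single_mul, one_mul, smul_eq_mul, submatrix_apply,
    kroneckerMap_apply, transpose_apply, Equiv.prodProdProdComm_apply]

variable [Fintype α'] [Fintype β'] [DecidableEq α'] [DecidableEq β']

namespace OpClass

theorem channels_PPT_subset_PPTplusPreserving :
    (PPT.channels : Set (OpMap (α × β) (α' × β'))) ⊆ PPTplusPreserving.channels :=
  fun _ hΛ => ⟨hΛ.1, fun _ hX => ⟨(hΛ.1.2 _).trans hX.1, hΛ.1.posSemidef_map hX.2.1,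
    posSemidef_partialTransposeConj_apply hΛ.2 hX.2.2⟩⟩

theorem channels_PPT_subset_RainsPreserving :
    (PPT.channels : Set (OpMap (α × β) (α' × β'))) ⊆ RainsPreserving.channels :=
  fun _ hΛ => ⟨hΛ.1, fun _ hX => ⟨hΛ.1.posSemidef_map hX.1,
    (traceNorm_map_le (fun _ => posSemidef_partialTransposeConj_apply hΛ.2)
      (trace_partialTransposeConj_apply hΛ.1.2) (isHermitian_partialTranspose hX.1.1)).trans hX.2⟩⟩

theorem isCPTP_of_mem_channels {O : OpClass} {Λ : OpMap (α × β) (α' × β')}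
    (hΛ : Λ ∈ O.channels) : IsCPTP Λ := by
  cases O <;> exact hΛ.1

theorem map_mem_Rains_of_mem_SEP {O : OpClass} {Λ : OpMap (α × β) (α' × β')}
    (hΛ : Λ ∈ O.channels) {X : Matrix (α × β) (α × β) ℂ} (hX : X ∈ SEP) : Λ X ∈ Rains := by
  have hXppt := SEP_subset_PPTplus hX
  cases O with
  | PPT => exact (channels_PPT_subset_RainsPreserving hΛ).2 _ (PPTplus_subset_Rains hXppt)
  | RainsPreserving => exact hΛ.2 _ (PPTplus_subset_Rains hXppt)
  | PPTplusPreserving => exact PPTplus_subset_Rains (hΛ.2 _ hXppt)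
  | SEPP => exact PPTplus_subset_Rains (SEP_subset_PPTplus (hΛ.2 _ hX))

end OpClass

end Classes

/-! ### Separability of mixtures with the maximally entangled state -/

section Separability

theorem ketbra_single {ι : Type*} [DecidableEq ι] (i : ι) :
    ketbra (EuclideanSpace.single i 1) (EuclideanSpace.single i 1) = single i i 1 := by
  ext x y
  simp only [ketbra, of_apply, PiLp.single_apply, single_apply, apply_ite star, star_one, star_zero,
    mul_ite, mul_one, mul_zero, ← ite_and]
  exact ite_cond_congr (propext (by tauto))

theorem tensorKet_single {α β : Type*} [DecidableEq α] [DecidableEq β] (p : α × β) :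
    tensorKet (EuclideanSpace.single p.1 1) (EuclideanSpace.single p.2 1) =
      EuclideanSpace.single p 1 := by
  ext q
  simp only [tensorKet, PiLp.single_apply, Prod.ext_iff, mul_ite, mul_one, mul_zero, ← ite_and]
  exact ite_cond_congr (propext and_comm)

theorem single_mem_SEP {α β : Type*} [Fintype α] [Fintype β] [DecidableEq α] [DecidableEq β]
    (p : α × β) : single p p 1 ∈ SEP := by
  rw [← ketbra_single, ← tensorKet_single]
  exact ketbra_tensorKet_mem_SEP (by rw [PiLp.norm_single, norm_one])
    (by rw [PiLp.norm_single, norm_one])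

/-- The normalised projector onto `span {|ij⟩ | i ≠ j}`. -/
noncomputable def offDiagState (m : ℕ) : Matrix (Fin m × Fin m) (Fin m × Fin m) ℂ :=
  ∑ p ∈ Finset.univ.offDiag, ((m : ℝ) * (m - 1))⁻¹ • single p p 1

theorem offDiagState_apply (m : ℕ) (p q : Fin m × Fin m) :
    offDiagState m p q = if p = q ∧ p.1 ≠ p.2 then ((m : ℂ) * (m - 1))⁻¹ else 0 := by
  simp only [offDiagState, Matrix.sum_apply, Matrix.smul_apply, single_apply, ite_and, smul_ite,
    smul_zero, Finset.sum_ite_eq', Finset.mem_offDiag, Finset.mem_univ, true_and]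
  by_cases hpq : p = q <;> simp [hpq]

theorem offDiagState_mem_SEP {m : ℕ} (hm : 2 ≤ m) : offDiagState m ∈ SEP := by
  have hm' : (2 : ℝ) ≤ m := Nat.ofNat_le_cast.mpr hm
  have hpos : 0 < (m : ℝ) * (m - 1) := mul_pos (by linarith) (by linarith)
  refine (convex_convexHull ℝ _).sum_mem (fun p _ => (inv_pos.mpr hpos).le) ?_
    fun p _ => single_mem_SEP p
  rw [Finset.sum_const, Finset.offDiag_card, Finset.card_univ, Fintype.card_fin, nsmul_eq_mul,
    Nat.cast_sub (Nat.le_mul_self m), Nat.cast_mul, ← mul_sub_one, mul_inv_cancel₀ hpos.ne']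

theorem trace_offDiagState_mul_maxEnt (m : ℕ) : (offDiagState m * maxEnt m).trace = 0 := by
  simp only [trace, diag_apply, mul_apply, offDiagState_apply, maxEnt_apply]
  refine Finset.sum_eq_zero fun p _ => Finset.sum_eq_zero fun q _ => ?_
  split_ifs <;> simp_all

theorem forall_sub_sub_add_eq_zero_iff {ι : Type*} (i j k l : ι) :
    (∀ f : ι → ZMod 3, f i - f j - f k + f l = 0) ↔ (i = j ∧ k = l) ∨ (i = k ∧ j = l) := by
  classical
  constructor
  · intro h
    have hi := h (Pi.single i 1)
    have hj := h (Pi.single j 1)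
    have hk := h (Pi.single k 1)
    have : (1 : ZMod 3) + 1 ≠ 0 := by decide
    have : (1 : ZMod 3) ≠ 0 := by decide
    simp only [Pi.single_apply] at hi hj hk
    grind
  · rintro (⟨rfl, rfl⟩ | ⟨rfl, rfl⟩) f <;> ring

section Phase

variable {ι : Type*}

/-- The character `f ↦ χ(fᵢ - fⱼ - fₖ + fₗ)` of `(ℤ/3)^ι`, for `p = (i, j)` and `q = (k, l)`: the
phase of the coherence `|p⟩⟨q|`. With `ℤ/2` in place of `ℤ/3` the coherences `|ij⟩⟨ji|` would have
phase `1` too. -/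
noncomputable def phaseChar (p q : ι × ι) : AddChar (ι → ZMod 3) ℂ :=
  (ZMod.stdAddChar (N := 3)).compAddMonoidHom
    (let ev := Pi.evalAddMonoidHom fun _ : ι => ZMod 3
    ev p.1 - ev p.2 - ev q.1 + ev q.2)

theorem phaseChar_apply (p q : ι × ι) (f : ι → ZMod 3) :
    phaseChar p q f = ZMod.stdAddChar (f p.1 - f p.2 - f q.1 + f q.2) := rfl

theorem phaseChar_eq_zero_iff (p q : ι × ι) :
    phaseChar p q = 0 ↔ (p.1 = p.2 ∧ q.1 = q.2) ∨ p = q := by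
  rw [Prod.ext_iff, ← forall_sub_sub_add_eq_zero_iff, AddChar.ext_iff]
  refine forall_congr' fun f => ?_
  rw [phaseChar_apply, AddChar.zero_apply, ← AddChar.map_zero_eq_one (ZMod.stdAddChar (N := 3)),
    ZMod.injective_stdAddChar.eq_iff]

theorem sum_phaseChar [Fintype ι] [DecidableEq ι] (p q : ι × ι) :
    ∑ f, phaseChar p q f =
      if (p.1 = p.2 ∧ q.1 = q.2) ∨ p = q then (3 : ℂ) ^ Fintype.card ι else 0 := by
  classical
  rw [AddChar.sum_eq_ite, ite_cond_congr (propext (phaseChar_eq_zero_iff p q)), Fintype.card_fun,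
    ZMod.card, Nat.cast_pow, Nat.cast_ofNat]

end Phase

variable {m : ℕ}

/-- The unit vector `φ_f = ∑ₖ χ(fₖ) |k⟩ / √m` with phases `f`. -/
noncomputable def phaseKet (f : Fin m → ZMod 3) : EuclideanSpace ℂ (Fin m) :=
  WithLp.toLp 2 fun k => (Real.sqrt m : ℂ)⁻¹ * ZMod.stdAddChar (f k)

theorem norm_phaseKet (hm : m ≠ 0) (f : Fin m → ZMod 3) : ‖phaseKet f‖ = 1 := by
  have hm' : (m : ℝ) ≠ 0 := Nat.cast_ne_zero.mpr hm
  rw [← sq_eq_sq₀ (norm_nonneg _) zero_le_one, EuclideanSpace.norm_sq_eq]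
  simp [phaseKet, AddChar.norm_apply, hm']

theorem ketbra_tensorKet_phaseKet (f : Fin m → ZMod 3) (p q : Fin m × Fin m) :
    ketbra (tensorKet (phaseKet f) (phaseKet (-f))) (tensorKet (phaseKet f) (phaseKet (-f))) p q =
      ((m : ℂ) ^ 2)⁻¹ * phaseChar p q f := by
  have hsqrt : (Real.sqrt m : ℂ) * (Real.sqrt m : ℂ) = m := by
    rw [← Complex.ofReal_mul, Real.mul_self_sqrt (Nat.cast_nonneg m), Complex.ofReal_natCast]
  have hstar (x : ZMod 3) : star (ZMod.stdAddChar x : ℂ) = ZMod.stdAddChar (-x) :=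
    (AddChar.map_neg_eq_conj _ _).symm
  have hchar : phaseChar p q f = ZMod.stdAddChar (f p.1) * ZMod.stdAddChar (-f p.2) *
      (ZMod.stdAddChar (-f q.1) * ZMod.stdAddChar (f q.2)) := by
    simp only [phaseChar_apply, sub_eq_add_neg, AddChar.map_add_eq_mul, mul_assoc]
  simp only [ketbra, tensorKet, phaseKet, of_apply, star_mul', hstar, Pi.neg_apply, neg_neg, hchar,
    star_inv₀, Complex.star_def, Complex.conj_ofReal]
  rw [← hsqrt]
  ring

theorem sum_ketbra_phaseKet (hm : 2 ≤ m) :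
    ∑ f : Fin m → ZMod 3, ((3 : ℝ) ^ m)⁻¹ •
        ketbra (tensorKet (phaseKet f) (phaseKet (-f))) (tensorKet (phaseKet f) (phaseKet (-f))) =
      (m : ℝ)⁻¹ • maxEnt m + (1 - (m : ℝ)⁻¹) • offDiagState m := by
  have hm₀ : (m : ℂ) ≠ 0 := Nat.cast_ne_zero.mpr (by omega)
  have hm₁ : (m : ℂ) - 1 ≠ 0 := sub_ne_zero.mpr (Nat.cast_ne_one.mpr (by omega))
  ext p q
  simp only [Matrix.sum_apply, Matrix.smul_apply, ketbra_tensorKet_phaseKet, Complex.real_smul,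
    ← Finset.mul_sum, sum_phaseChar, Matrix.add_apply, maxEnt_apply, offDiagState_apply,
    Fintype.card_fin]
  push_cast
  by_cases hdiag : p.1 = p.2 ∧ q.1 = q.2
  · simp only [hdiag, and_self, true_or, if_true, one_div, ne_eq, not_true_eq_false, and_false,
      if_false, mul_zero, add_zero]
    field_simp
  · by_cases hpq : p = q
    · subst hpq
      have hp : p.1 ≠ p.2 := fun h => hdiag ⟨h, h⟩
      simp only [hp, and_self, or_true, if_true, if_false, mul_zero, ne_eq, not_false_eq_true,
        _root_.mul_inv_rev, zero_add]
      field_simp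
    · simp [hdiag, hpq]

/-- Averaging the product states `|φ_f φ_{-f}⟩` over all phases `f` cancels the coherences outside
`span {|ii⟩}`. -/
theorem inv_smul_maxEnt_add_smul_offDiagState_mem_SEP (hm : 2 ≤ m) :
    (m : ℝ)⁻¹ • maxEnt m + (1 - (m : ℝ)⁻¹) • offDiagState m ∈ SEP := by
  rw [← sum_ketbra_phaseKet hm]
  refine (convex_convexHull ℝ _).sum_mem (fun _ _ => by positivity) ?_ fun f _ =>
    ketbra_tensorKet_mem_SEP (norm_phaseKet (by omega) _) (norm_phaseKet (by omega) _)
  simp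

theorem smul_maxEnt_add_smul_offDiagState_mem_SEP (hm : 2 ≤ m) {t : ℝ} (ht₀ : 0 ≤ t)
    (ht : m * t ≤ 1) :
    t • maxEnt m + (1 - t) • offDiagState m ∈ SEP := by
  have hm₀ : (m : ℝ) ≠ 0 := Nat.cast_ne_zero.mpr (by omega)
  have hconv := (convex_convexHull ℝ _ : Convex ℝ (SEP (α := Fin m) (β := Fin m)))
    (inv_smul_maxEnt_add_smul_offDiagState_mem_SEP hm) (offDiagState_mem_SEP hm)
    (mul_nonneg m.cast_nonneg ht₀) (sub_nonneg.mpr ht) (add_sub_cancel _ _)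
  convert! hconv using 1
  rw [smul_add, smul_smul, smul_smul, add_assoc, ← add_smul]
  congr 2 <;> field_simp
  ring

end Separability

/-! ### Distillation by measuring and preparing -/

section MeasurePrepare

theorem measurePrepare_apply_of_isState {ι κ : Type*} [Fintype ι] [DecidableEq ι]
    {M : Matrix ι ι ℂ} (hM : M.PosSemidef) (σ τ : Matrix κ κ ℂ) {ρ : Matrix ι ι ℂ}
    (hρ : IsState ρ) :
    measurePrepare M σ τ ρ = (ρ * M).trace.re • σ + (1 - (ρ * M).trace.re) • τ := by
  have hreal : (ρ * M).trace = ((ρ * M).trace.re : ℂ) :=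
    Complex.ext rfl (Complex.nonneg_iff.mp (trace_mul_nonneg hρ.1 hM)).2.symm
  rw [measurePrepare_apply, Matrix.mul_sub, Matrix.mul_one, trace_sub, hρ.2, hreal,
    ← Complex.ofReal_one, ← Complex.ofReal_sub, Complex.ofReal_re, Complex.coe_smul,
    Complex.coe_smul]

theorem hs_measurePrepare_maxEnt {ι : Type*} [Fintype ι] [DecidableEq ι] {m : ℕ} (hm : m ≠ 0)
    {M ρ : Matrix ι ι ℂ} (hM : M.PosSemidef) (hρ : IsState ρ)
    {τ : Matrix (Fin m × Fin m) (Fin m × Fin m) ℂ} (hτ : τ.IsHermitian)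
    (hτm : (τ * maxEnt m).trace = 0) :
    hs (measurePrepare M (maxEnt m) τ ρ) (maxEnt m) = (ρ * M).trace.re := by
  have hherm (t : ℝ) {X : Matrix (Fin m × Fin m) (Fin m × Fin m) ℂ} (hX : X.IsHermitian) :
      (t • X).IsHermitian := by rw [IsHermitian, conjTranspose_smul, star_trivial, hX.eq]
  rw [measurePrepare_apply_of_isState hM _ _ hρ,
    hs_eq_trace_mul_re ((hherm _ (posSemidef_maxEnt m).1).add (hherm _ hτ)), Matrix.add_mul,
    trace_add, smul_mul, smul_mul, trace_smul, trace_smul, maxEnt_mul_self hm,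
    (isState_maxEnt hm).2, hτm, smul_zero, add_zero, Complex.smul_re, Complex.one_re, smul_eq_mul,
    mul_one]

variable {α β : Type*} [Fintype α] [DecidableEq α] [Fintype β] [DecidableEq β] {m : ℕ}

/-- The normalised projector onto the complement of the maximally entangled vector. -/
noncomputable def complState (m : ℕ) : Matrix (Fin m × Fin m) (Fin m × Fin m) ℂ :=
  ((m : ℝ) ^ 2 - 1)⁻¹ • (1 - maxEnt m)

theorem isState_complState (hm : 2 ≤ m) : IsState (complState m) := by
  have hpos : (0 : ℝ) < (m : ℝ) ^ 2 - 1 :=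
    sub_pos.mpr (one_lt_pow₀ (Nat.one_lt_cast.mpr hm) two_ne_zero)
  refine ⟨(isEffect_maxEnt (by omega)).2.smul (inv_nonneg.mpr hpos.le), ?_⟩
  have hpos' : (m : ℂ) ^ 2 - 1 ≠ 0 := by exact_mod_cast hpos.ne'
  rw [complState, trace_smul, trace_sub, (isState_maxEnt (by omega)).2, trace_one,
    Complex.real_smul, Fintype.card_prod, Fintype.card_fin]
  push_cast
  rw [← sq, inv_mul_cancel₀ hpos']

theorem trace_complState_mul_maxEnt (hm : m ≠ 0) : (complState m * maxEnt m).trace = 0 := by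
  rw [complState, smul_mul, Matrix.sub_mul, Matrix.one_mul, maxEnt_mul_self hm, sub_self,
    smul_zero, trace_zero]

theorem kronecker_smul_add_one_sub_kronecker_smul {ι κ : Type*} [DecidableEq ι] [DecidableEq κ]
    (N : Matrix ι ι ℂ) (F : Matrix κ κ ℂ) {t : ℝ} (ht₀ : t ≠ 0) (ht₁ : t + 1 ≠ 0)
    (ht₂ : t - 1 ≠ 0) :
    N ⊗ₖ ((1 / t) • F) + (1 - N) ⊗ₖ ((t ^ 2 - 1)⁻¹ • (1 - (1 / t) • F)) =
      (2 * t * (t + 1))⁻¹ • ((1 + t • N) ⊗ₖ (1 + F)) +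
        (2 * t * (t - 1))⁻¹ • ((1 - t • N) ⊗ₖ (1 - F)) := by
  have ht₀' : (t : ℂ) ≠ 0 := Complex.ofReal_ne_zero.mpr ht₀
  have ht₁' : (t : ℂ) + 1 ≠ 0 := by exact_mod_cast ht₁
  have ht₂' : (t : ℂ) - 1 ≠ 0 := by exact_mod_cast ht₂
  have hsq : (t : ℂ) ^ 2 - 1 = (t - 1) * (t + 1) := by ring
  ext p q
  simp only [Matrix.add_apply, Matrix.sub_apply, Matrix.smul_apply, kroneckerMap_apply,
    Complex.real_smul]
  push_cast
  rw [hsq]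
  field_simp
  ring

theorem measurePrepare_complState_mem_PPT (hm : 2 ≤ m) {M : Matrix (α × β) (α × β) ℂ}
    (hM : IsEffect M) (hadd : (1 + (m : ℝ) • partialTranspose M).PosSemidef)
    (hsub : (1 - (m : ℝ) • partialTranspose M).PosSemidef) :
    measurePrepare M (maxEnt m) (complState m) ∈ OpClass.PPT.channels := by
  refine ⟨isCPTP_measurePrepare hM (isState_maxEnt (by omega)) (isState_complState hm), ?_⟩
  have hm' : (2 : ℝ) ≤ m := Nat.ofNat_le_cast.mpr hm
  have hadd' := hadd.transpose
  have hsub' := hsub.transpose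
  rw [transpose_add, transpose_one, transpose_smul] at hadd'
  rw [transpose_sub, transpose_one, transpose_smul] at hsub'
  have hc₁ : (0 : ℝ) ≤ (2 * (m : ℝ) * (m + 1))⁻¹ := by positivity
  have hc₂ : (0 : ℝ) ≤ (2 * (m : ℝ) * (m - 1))⁻¹ :=
    inv_nonneg.mpr (mul_nonneg (by linarith) (by linarith))
  rw [partialTranspose_choi_measurePrepare, complState, partialTranspose_smul,
    partialTranspose_sub, partialTranspose_one, partialTranspose_maxEnt, transpose_sub,
    transpose_one, kronecker_smul_add_one_sub_kronecker_smul _ _ (by linarith) (by linarith)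
      (by linarith)]
  exact (((hadd'.kronecker posSemidef_one_add_swapOperator).smul hc₁).add
    ((hsub'.kronecker posSemidef_one_sub_swapOperator).smul hc₂)).submatrix _

theorem measurePrepare_offDiagState_mem_SEPP (hm : 2 ≤ m) {M : Matrix (α × β) (α × β) ℂ}
    (hM : IsEffect M) (hsub : (1 - (m : ℝ) • partialTranspose M).PosSemidef) :
    measurePrepare M (maxEnt m) (offDiagState m) ∈ OpClass.SEPP.channels := by
  refine ⟨isCPTP_measurePrepare hM (isState_maxEnt (by omega))
    (isState_of_mem_SEP (offDiagState_mem_SEP hm)), fun X hX => ?_⟩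
  rw [measurePrepare_apply_of_isState hM.1 _ _ (isState_of_mem_SEP hX)]
  obtain ⟨htr, hXpos, hXpt⟩ := SEP_subset_PPTplus hX
  refine smul_maxEnt_add_smul_offDiagState_mem_SEP hm (trace_mul_re_nonneg hXpos hM.1)
    (sub_nonneg.mp ?_)
  have hle := trace_mul_re_nonneg hXpt hsub
  rwa [Matrix.mul_sub, Matrix.mul_one, trace_sub, trace_partialTranspose, htr, Matrix.mul_smul,
    trace_smul, trace_partialTranspose_mul_partialTranspose, Complex.sub_re, Complex.smul_re,
    Complex.one_re, smul_eq_mul] at hle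

namespace OpClass

theorem mem_channels_of_mem_PPT_of_mem_SEPP {α' β' : Type*} [Fintype α'] [DecidableEq α']
    [Fintype β'] [DecidableEq β'] {Λ : OpMap (α × β) (α' × β')} (hPPT : Λ ∈ PPT.channels)
    (hSEPP : Λ ∈ SEPP.channels) (O : OpClass) : Λ ∈ O.channels := by
  cases O with
  | PPT => exact hPPT
  | RainsPreserving => exact channels_PPT_subset_RainsPreserving hPPT
  | PPTplusPreserving => exact channels_PPT_subset_PPTplusPreserving hPPT
  | SEPP => exact hSEPP

theorem measurePrepare_one_mem_channels {α' β' : Type*} [Fintype α'] [DecidableEq α']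
    [Fintype β'] [DecidableEq β'] {σ : Matrix (α' × β') (α' × β') ℂ} (hσ : σ ∈ SEP)
    (O : OpClass) : measurePrepare (1 : Matrix (α × β) (α × β) ℂ) σ σ ∈ O.channels := by
  have hone : IsEffect (1 : Matrix (α × β) (α × β) ℂ) := isEffect_one
  have hCP := isCPTP_measurePrepare hone (isState_of_mem_SEP hσ) (isState_of_mem_SEP hσ)
  refine mem_channels_of_mem_PPT_of_mem_SEPP ⟨hCP, ?_⟩ ⟨hCP, fun X hX => ?_⟩ O
  · rw [partialTranspose_choi_measurePrepare, partialTranspose_one, sub_self, transpose_zero,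
      zero_kronecker, add_zero, transpose_one]
    exact (PosSemidef.one.kronecker (SEP_subset_PPTplus hσ).2.2).submatrix _
  · rwa [measurePrepare_apply_of_isState hone.1 _ _ (isState_of_mem_SEP hX), ← add_smul,
      add_sub_cancel, one_smul]

end OpClass

theorem maxEnt_one_mem_SEP : maxEnt 1 ∈ SEP := by
  have h : maxEnt 1 = single (0, 0) (0, 0) 1 := by
    ext p q
    simp [maxEnt_apply, Subsingleton.elim p (0, 0), Subsingleton.elim q (0, 0)]
  exact h ▸ single_mem_SEP _

end MeasurePrepare

/-! ### The fidelity of distillation of a maximally correlated state -/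

section Fidelity

/-- The effects whose diagonal entries are at most `t`, i.e. the feasible set of `G` written in the
incoherent basis. -/
def diagBoundedEffects (n : Type*) [DecidableEq n] (t : ℝ) : Set (Matrix n n ℂ) :=
  {A | IsEffect A ∧ ∀ i, (A i i).re ≤ t}

theorem trace_mul_conjTranspose_mul_heisenbergDual_mul {n ι κ : Type*} [Fintype n] [Fintype ι]
    [DecidableEq ι] [Fintype κ] (Λ : OpMap ι κ) (V : Matrix ι n ℂ) (X : Matrix n n ℂ)
    (E : Matrix κ κ ℂ) :
    (X * (Vᴴ * heisenbergDual Λ E * V)).trace = (Λ (V * X * Vᴴ) * E).trace := by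
  rw [← trace_mul_heisenbergDual, Matrix.mul_assoc Vᴴ, ← Matrix.mul_assoc X, ← trace_mul_comm,
    Matrix.mul_assoc, trace_mul_comm]
  simp only [Matrix.mul_assoc]

variable {n : Type*} [Fintype n] [DecidableEq n]
  (a b : OrthonormalBasis n ℂ (EuclideanSpace ℂ n)) {r : Matrix n n ℂ} (O : OpClass) {m : ℕ}

theorem fidelity_maxCorr_le (hr : r.PosSemidef) (hm : m ≠ 0) :
    fidelity O (maxCorr a b r) m ≤
      ⨆ A ∈ diagBoundedEffects n (1 / m), ((hs r A : ℝ) : EReal) := by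
  refine iSup₂_le fun Λ hΛ => ?_
  have hCP := OpClass.isCPTP_of_mem_channels hΛ
  let A := (pairIsometry a b)ᴴ * heisenbergDual Λ (maxEnt m) * pairIsometry a b
  have hA {X : Matrix n n ℂ} (hX : X.PosSemidef) :
      hs (Λ (maxCorr a b X)) (maxEnt m) = (X * A).trace.re := by
    rw [hs_eq_trace_mul_re (hCP.posSemidef_map (posSemidef_maxCorr a b hX)).1, maxCorr_eq,
      trace_mul_conjTranspose_mul_heisenbergDual_mul]
  refine le_iSup₂_of_le A ⟨?_, fun i => ?_⟩ (by rw [hA hr, hs_eq_trace_mul_re hr.1])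
  · exact IsEffect.compress
      (isEffect_heisenbergDual (fun _ => hCP.posSemidef_map) hCP.2 (isEffect_maxEnt hm))
      (conjTranspose_pairIsometry_mul_self a b)
  · have hle := hs_maxEnt_le_of_mem_Rains (O.map_mem_Rains_of_mem_SEP hΛ
      (ketbra_tensorKet_mem_SEP (a.norm_eq_one i) (b.norm_eq_one i)))
    rwa [← maxCorr_single, hA (ketbra_single i ▸ posSemidef_ketbra _), trace_single_mul,
      one_smul] at hle

variable {O}

theorem exists_channel_hs_maxEnt_eq (hr : IsState r) (hm : 2 ≤ m) {A : Matrix n n ℂ}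
    (hA : A ∈ diagBoundedEffects n (1 / m)) :
    ∃ Λ ∈ O.channels, hs (Λ (maxCorr a b r)) (maxEnt m) = (r * A).trace.re := by
  have hm₀ : (0 : ℝ) < m := Nat.cast_pos.mpr (by omega)
  have hnorm (i j : n) : ‖((m : ℝ) • A) i j‖ ≤ 1 := by
    rw [Matrix.smul_apply, norm_smul, Real.norm_natCast, ← le_div_iff₀' hm₀]
    exact norm_apply_le_of_diag_le hA.1.1 hA.2 i j
  have hherm := (hA.1.1.smul hm₀.le).1
  have hadd := posSemidef_one_add_partialTranspose_maxCorr a b hherm hnorm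
  have hsub := posSemidef_one_sub_partialTranspose_maxCorr a b hherm hnorm
  rw [maxCorr_smul, partialTranspose_smul] at hadd hsub
  have hM := isEffect_maxCorr a b hA.1
  have hvalue {τ : Matrix (Fin m × Fin m) (Fin m × Fin m) ℂ} (hτ : IsState τ)
      (hτm : (τ * maxEnt m).trace = 0) :
      hs (measurePrepare (maxCorr a b A) (maxEnt m) τ (maxCorr a b r)) (maxEnt m) =
        (r * A).trace.re := by
    rw [hs_measurePrepare_maxEnt (by omega) hM.1 (isState_maxCorr a b hr) hτ.1.1 hτm,
      maxCorr_mul_maxCorr, trace_maxCorr]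
  have hPPT := measurePrepare_complState_mem_PPT hm hM hadd hsub
  have hcompl := hvalue (isState_complState hm) (trace_complState_mul_maxEnt (by omega))
  cases O with
  | PPT => exact ⟨_, hPPT, hcompl⟩
  | RainsPreserving => exact ⟨_, OpClass.channels_PPT_subset_RainsPreserving hPPT, hcompl⟩
  | PPTplusPreserving => exact ⟨_, OpClass.channels_PPT_subset_PPTplusPreserving hPPT, hcompl⟩
  | SEPP => exact ⟨_, measurePrepare_offDiagState_mem_SEPP hm hM hsub,
      hvalue (isState_of_mem_SEP (offDiagState_mem_SEP hm)) (trace_offDiagState_mul_maxEnt m)⟩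

theorem le_fidelity_maxCorr (hr : IsState r) (hm : m ≠ 0) :
    ⨆ A ∈ diagBoundedEffects n (1 / m), ((hs r A : ℝ) : EReal) ≤
      fidelity O (maxCorr a b r) m := by
  refine iSup₂_le fun A hA => ?_
  obtain rfl | hm' : m = 1 ∨ 2 ≤ m := by omega
  · refine le_iSup₂_of_le _ (O.measurePrepare_one_mem_channels maxEnt_one_mem_SEP)
      (EReal.coe_le_coe_iff.mpr ?_)
    have hle := trace_mul_re_nonneg hr.1 hA.1.2
    rw [Matrix.mul_sub, Matrix.mul_one, trace_sub, hr.2, Complex.sub_re, sub_nonneg] at hle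
    rwa [measurePrepare_apply_of_isState PosSemidef.one _ _ (isState_maxCorr a b hr), ← add_smul,
      add_sub_cancel, one_smul, hs_eq_trace_mul_re hr.1.1,
      hs_eq_trace_mul_re (posSemidef_maxEnt 1).1, maxEnt_mul_self one_ne_zero,
      (isState_maxEnt one_ne_zero).2]
  · obtain ⟨Λ, hΛ, heq⟩ := exists_channel_hs_maxEnt_eq a b hr hm' hA
    exact le_iSup₂_of_le Λ hΛ (by rw [heq, hs_eq_trace_mul_re hr.1.1])

variable (O) in
theorem fidelity_maxCorr (hr : IsState r) (hm : m ≠ 0) :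
    fidelity O (maxCorr a b r) m =
      ⨆ A ∈ diagBoundedEffects n (1 / m), ((hs r A : ℝ) : EReal) :=
  (fidelity_maxCorr_le a b O hr.1 hm).antisymm (le_fidelity_maxCorr a b hr hm)

end Fidelity

/-! ### Change of basis -/

section ChangeOfBasis

variable {n : Type*} [Fintype n]

theorem hs_comm (X Y : Matrix n n ℂ) : hs X Y = hs Y X := by
  rw [hs, ← Complex.conj_re, starRingEnd_apply, ← trace_conjTranspose, conjTranspose_mul,
    conjTranspose_conjTranspose, hs]

theorem real_smul_hs (t : ℝ) (X Y : Matrix n n ℂ) : hs (t • X) Y = t * hs X Y := by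
  rw [hs, conjTranspose_smul, star_trivial, smul_mul, trace_smul, Complex.smul_re, smul_eq_mul, hs]

theorem convexHull_range_eq_image_stdSimplex {E : Type*} [AddCommGroup E] [Module ℝ E]
    (v : n → E) :
    convexHull ℝ (Set.range v) = (fun p : n → ℝ => ∑ i, p i • v i) '' stdSimplex ℝ n := by
  classical
  have hrange : Set.range v =
      Fintype.linearCombination ℝ v '' Set.range fun i : n => Pi.single i (1 : ℝ) := by
    rw [← Set.range_comp]
    congr 1 with i
    rw [Function.comp_apply, Fintype.linearCombination_apply_single, one_smul]
  rw [hrange, ← LinearMap.image_convexHull, convexHull_rangle_single_eq_stdSimplex]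
  rfl

theorem forall_dotProduct_le_iff {x : n → ℝ} {t : ℝ} :
    (∀ p ∈ stdSimplex ℝ n, p ⬝ᵥ x ≤ t) ↔ ∀ i, x i ≤ t := by
  refine ⟨fun h i => ?_, fun h p hp => ?_⟩
  · classical
    simpa only [single_one_dotProduct] using h _ (single_mem_stdSimplex ℝ i)
  · calc p ⬝ᵥ x ≤ p ⬝ᵥ fun _ => t := dotProduct_le_dotProduct_of_nonneg_left h hp.1
      _ = t := by rw [dotProduct, ← Finset.sum_mul, hp.2, one_mul]

/-- The real parts of the diagonal entries of a matrix. -/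
def diagRe : Matrix n n ℂ →L[ℝ] n → ℝ where
  toFun A i := (A i i).re
  map_add' _ _ := rfl
  map_smul' t A := funext fun i => Complex.smul_re t (A i i)
  cont := by fun_prop

variable [DecidableEq n] (c : OrthonormalBasis n ℂ (EuclideanSpace ℂ n))

theorem hs_diagonal (A : Matrix n n ℂ) (p : n → ℝ) :
    hs A (diagonal fun i => (p i : ℂ)) = p ⬝ᵥ diagRe A := by
  simp only [hs, trace, diag_apply, mul_diagonal, conjTranspose_apply, Complex.re_sum,
    Complex.re_mul_ofReal, ← starRingEnd_apply, Complex.conj_re]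
  exact Finset.sum_congr rfl fun i _ => mul_comm _ _

/-- The operator whose matrix in the orthonormal basis `c` is the given one, as a `⋆`-algebra
automorphism. -/
noncomputable def inBasis : Matrix n n ℂ ≃⋆ₐ[ℂ] Matrix n n ℂ :=
  Unitary.conjStarAlgAut ℂ _ ⟨columnMatrix c, columnMatrix_mem_unitaryGroup c⟩

theorem inBasis_apply (A : Matrix n n ℂ) :
    inBasis c A = columnMatrix c * A * (columnMatrix c)ᴴ :=
  rfl

theorem singleParty_eq_inBasis (r : Matrix n n ℂ) : singleParty c r = inBasis c r :=
  sum_smul_ketbra _ r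

theorem ketbra_eq_inBasis (i : n) : ketbra (c i) (c i) = inBasis c (single i i 1) := by
  rw [← singleParty_eq_inBasis]
  simp [singleParty, single_apply, ite_and]

theorem trace_inBasis (A : Matrix n n ℂ) : (inBasis c A).trace = A.trace := by
  rw [inBasis_apply, trace_mul_comm, ← Matrix.mul_assoc,
    conjTranspose_columnMatrix_mul_self c.orthonormal, Matrix.one_mul]

theorem hs_inBasis (A B : Matrix n n ℂ) : hs (inBasis c A) (inBasis c B) = hs A B := by
  rw [hs, ← star_eq_conjTranspose, ← map_star, ← map_mul, trace_inBasis, star_eq_conjTranspose, hs]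

variable {c}

theorem posSemidef_inBasis_iff {A : Matrix n n ℂ} :
    (inBasis c A).PosSemidef ↔ A.PosSemidef :=
  IsUnit.posSemidef_star_right_conjugate_iff
    (Unitary.isUnit_coe (U := ⟨columnMatrix c, columnMatrix_mem_unitaryGroup c⟩))

theorem isEffect_inBasis_iff {A : Matrix n n ℂ} : IsEffect (inBasis c A) ↔ IsEffect A := by
  have hsub : 1 - inBasis c A = inBasis c (1 - A) := by rw [map_sub, map_one]
  rw [IsEffect, IsEffect, hsub, posSemidef_inBasis_iff, posSemidef_inBasis_iff]

theorem opNorm_inBasis (A : Matrix n n ℂ) : opNorm (inBasis c A) = opNorm A := by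
  open scoped Matrix.Norms.L2Operator in
  rw [opNorm, opNorm, l2_opNorm_toEuclideanCLM, l2_opNorm_toEuclideanCLM, StarAlgEquiv.norm_map]

theorem dephase_inBasis (A : Matrix n n ℂ) :
    dephase c (inBasis c A) = inBasis c (diagonal A.diag) := by
  simp only [dephase, ketbra_eq_inBasis, ← map_mul, ← map_sum, single_mul_mul_single, one_mul,
    mul_one, sum_single_eq_diagonal]
  rfl

theorem incoherent_eq_image_stdSimplex :
    incoherent c =
      (fun p : n → ℝ => inBasis c (diagonal fun i => (p i : ℂ))) '' stdSimplex ℝ n := by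
  rw [incoherent, convexHull_range_eq_image_stdSimplex]
  congr 1 with p : 1
  simp only [ketbra_eq_inBasis, ← Complex.coe_smul, ← map_smul, ← map_sum, smul_single,
    smul_eq_mul, mul_one, sum_single_eq_diagonal]

theorem inBasis_mem_smul_polar_iff {t : ℝ} (ht : 0 < t) {A : Matrix n n ℂ} (hA : A.PosSemidef) :
    inBasis c A ∈ (1 / t) • polar (incoherent c) ↔ ∀ i, (A i i).re ≤ 1 / t := by
  have hherm : (t • inBasis c A).IsHermitian := ((posSemidef_inBasis_iff.mpr hA).smul ht.le).1
  rw [Set.mem_smul_set_iff_inv_smul_mem₀ (one_div_pos.mpr ht).ne', one_div, inv_inv, polar,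
    Set.mem_ofPred_eq, and_iff_right hherm, incoherent_eq_image_stdSimplex, Set.forall_mem_image]
  simp only [real_smul_hs, hs_inBasis, hs_diagonal, ← le_inv_mul_iff₀ ht, mul_one]
  exact forall_dotProduct_le_iff

theorem G_incoherent_inBasis {r : Matrix n n ℂ} {t : ℝ} (ht : 0 < t) :
    G t (incoherent c) (inBasis c r) =
      ⨆ A ∈ diagBoundedEffects n (1 / t), ((hs r A : ℝ) : EReal) := by
  refine ((EquivLike.surjective (inBasis c)).iSup_congr _ fun A => ?_).symm
  refine iSup_congr_Prop ?_ fun _ => by rw [hs_inBasis]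
  rw [diagBoundedEffects, Set.mem_ofPred_eq, Set.mem_ofPred_eq, isEffect_inBasis_iff]
  exact and_congr_right fun hA => inBasis_mem_smul_polar_iff ht hA.1

theorem opNorm_dephase_inBasis_le_iff {A : Matrix n n ℂ} (hA : A.PosSemidef) {t : ℝ} (ht : 0 ≤ t) :
    opNorm (dephase c (inBasis c A)) ≤ t ↔ ∀ i, (A i i).re ≤ t := by
  open scoped Matrix.Norms.L2Operator in
  rw [dephase_inBasis, opNorm_inBasis, opNorm, l2_opNorm_toEuclideanCLM, l2_opNorm_diagonal,
    pi_norm_le_iff_of_nonneg ht]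
  simp only [diag_apply, ← Complex.re_eq_norm.mpr hA.diag_nonneg]

theorem posSemidef_smul_one_sub_dephase_inBasis_iff {A : Matrix n n ℂ} (hA : A.PosSemidef)
    {t : ℝ} : ((t : ℂ) • (1 : Matrix n n ℂ) - dephase c (inBasis c A)).PosSemidef ↔
      ∀ i, (A i i).re ≤ t := by
  rw [dephase_inBasis, ← map_one (inBasis c), ← map_smul, ← map_sub, posSemidef_inBasis_iff,
    smul_one_eq_diagonal, diagonal_sub, posSemidef_diagonal_iff]
  refine forall_congr' fun i => ?_
  rw [diag_apply, sub_nonneg, Complex.le_def, Complex.ofReal_re, Complex.ofReal_im]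
  exact and_iff_left (Complex.nonneg_iff.mp hA.diag_nonneg).2.symm

end ChangeOfBasis

/-! ### Minimax for the diagonal entries of accepting effects -/

section Minimax

theorem exists_forall_apply_le_dotProduct {E ι : Type*} [AddCommGroup E] [Module ℝ E]
    [TopologicalSpace E] [IsTopologicalAddGroup E] [ContinuousSMul ℝ E] [Fintype ι] [Nonempty ι]
    (f : E →L[ℝ] ι → ℝ) {K : Set E} (hcompact : IsCompact K) (hconvex : Convex ℝ K)
    (hne : K.Nonempty) :
    ∃ x ∈ K, ∃ p ∈ stdSimplex ℝ ι, (∀ i, f x i ≤ p ⬝ᵥ f x) ∧ ∀ y ∈ K, p ⬝ᵥ f x ≤ p ⬝ᵥ f y := by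
  classical
  have hleft (p : ι → ℝ) : IsLinearMap ℝ fun x => p ⬝ᵥ f x :=
    ((dotProductBilin ℝ ℝ p).comp f.toLinearMap).isLinear
  have hright (x : E) : IsLinearMap ℝ fun p => p ⬝ᵥ f x :=
    ((dotProductBilin ℝ ℝ).flip (f x)).isLinear
  obtain ⟨x, hx, p, hp, hsaddle⟩ := Sion.exists_isSaddlePointOn (f := fun x p => p ⬝ᵥ f x)
    hne hconvex hcompact
    (fun p _ => (Continuous.lowerSemicontinuous (by fun_prop)).lowerSemicontinuousOn _)
    (fun p _ => ((hleft p).mk'.convexOn hconvex).quasiconvexOn)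
    (convex_stdSimplex ℝ ι) ⟨_, single_mem_stdSimplex ℝ (Classical.arbitrary ι)⟩
    (isCompact_stdSimplex ℝ ι)
    (fun x _ => (Continuous.upperSemicontinuous (by fun_prop)).upperSemicontinuousOn _)
    (fun x _ => ((hright x).mk'.concaveOn (convex_stdSimplex ℝ ι)).quasiconcaveOn)
  exact ⟨x, hx, p, hp, forall_dotProduct_le_iff.mp (hsaddle x hx), fun y hy => hsaddle y hy p hp⟩

variable {n : Type*}

section

variable [DecidableEq n]

open scoped MatrixOrder in
theorem convex_setOf_isEffect [Finite n] : Convex ℝ {A : Matrix n n ℂ | IsEffect A} :=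
  have := Fintype.ofFinite n
  setOf_isEffect (ι := n) ▸ convex_Icc 0 1

open scoped MatrixOrder Matrix.Norms.L2Operator in
theorem isCompact_setOf_isEffect [Finite n] :
    IsCompact {A : Matrix n n ℂ | IsEffect A} := by
  have := Fintype.ofFinite n
  rw [setOf_isEffect]
  have : ProperSpace (Matrix n n ℂ) := FiniteDimensional.proper ℂ _
  refine (isCompact_closedBall 0 1).of_isClosed_subset isClosed_Icc fun A hA => ?_
  exact mem_closedBall_zero_iff.mpr ((CStarAlgebra.norm_le_one_iff_of_nonneg A hA.1).mpr hA.2)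

theorem isCompact_diagBoundedEffects [Finite n] (t : ℝ) :
    IsCompact (diagBoundedEffects n t) := by
  refine isCompact_setOf_isEffect.inter_right
    (t := {A : Matrix n n ℂ | ∀ i, (A i i).re ≤ t}) ?_
  simp only [Set.ofPred_forall]
  exact isClosed_iInter fun i => isClosed_le (by fun_prop) continuous_const

end

variable [Fintype n]

theorem isLinearMap_hs (X : Matrix n n ℂ) : IsLinearMap ℝ (hs X) where
  map_add Y Z := by rw [hs, Matrix.mul_add, trace_add, Complex.add_re, hs, hs]
  map_smul t Y := by rw [hs_comm, real_smul_hs, hs_comm, smul_eq_mul]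

theorem continuous_hs (X : Matrix n n ℂ) : Continuous (hs X) := by
  unfold hs
  fun_prop

variable [DecidableEq n]

/-- The effects accepting `r` with probability at least `s`. -/
def acceptingEffects (r : Matrix n n ℂ) (s : ℝ) : Set (Matrix n n ℂ) :=
  {A | IsEffect A ∧ s ≤ hs r A}

/-- The numbers bounding all diagonal entries of some effect in `acceptingEffects r s`, i.e. the
feasible values of the semidefinite program `Δ(W) ⪯ t 𝟙` written in the incoherent basis. -/
def diagLevels (r : Matrix n n ℂ) (s : ℝ) : Set ℝ :=
  {t | ∃ A ∈ acceptingEffects r s, ∀ i, (A i i).re ≤ t}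

variable {r : Matrix n n ℂ} {s t w : ℝ}

theorem isCompact_acceptingEffects : IsCompact (acceptingEffects r s) :=
  isCompact_setOf_isEffect.inter_right (isClosed_le continuous_const (continuous_hs r))

theorem convex_acceptingEffects : Convex ℝ (acceptingEffects r s) :=
  convex_setOf_isEffect.inter (convex_halfSpace_ge (isLinearMap_hs r) s)

theorem one_mem_acceptingEffects (hr : IsState r) (hs : s ≤ 1) : 1 ∈ acceptingEffects r s := by
  refine ⟨isEffect_one, ?_⟩
  rwa [hs_eq_trace_mul_re hr.1.1, Matrix.mul_one, hr.2, Complex.one_re]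

theorem one_mem_diagLevels (hr : IsState r) (hs : s ≤ 1) : 1 ∈ diagLevels r s :=
  ⟨1, one_mem_acceptingEffects hr hs, fun i => by rw [one_apply_eq, Complex.one_re]⟩

theorem nonneg_of_mem_diagLevels [Nonempty n] (ht : t ∈ diagLevels r s) : 0 ≤ t := by
  obtain ⟨A, hA, hAt⟩ := ht
  exact (Complex.nonneg_iff.mp hA.1.1.diag_nonneg).1.trans (hAt (Classical.arbitrary n))

theorem mem_diagLevels_iff (hw : IsLeast (diagLevels r s) w) : t ∈ diagLevels r s ↔ w ≤ t :=
  ⟨fun ht => hw.2 ht, fun ht => hw.1.imp fun _ => And.imp_right fun h i => (h i).trans ht⟩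

theorem le_iSup_diagBoundedEffects_iff (ht : 0 ≤ t) :
    (s : EReal) ≤ ⨆ A ∈ diagBoundedEffects n t, ((hs r A : ℝ) : EReal) ↔ t ∈ diagLevels r s := by
  constructor
  · intro hle
    obtain ⟨A, hA, hmax⟩ := (isCompact_diagBoundedEffects (n := n) t).exists_isMaxOn
      ⟨0, isEffect_zero, fun _ => ht⟩ (continuous_hs r).continuousOn
    have hle' := hle.trans (iSup₂_le fun B hB => EReal.coe_le_coe_iff.mpr (hmax hB))
    exact ⟨A, ⟨hA.1, EReal.coe_le_coe_iff.mp hle'⟩, hA.2⟩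
  · rintro ⟨A, ⟨hA, hacc⟩, hAt⟩
    exact le_iSup₂_of_le A ⟨hA, hAt⟩ (EReal.coe_le_coe_iff.mpr hacc)

theorem exists_isLeast_diagLevels [Nonempty n] (hr : IsState r) (hs : s ≤ 1) :
    ∃ w, IsLeast (diagLevels r s) w ∧
      ∃ p ∈ stdSimplex ℝ n, IsLeast ((fun A => p ⬝ᵥ diagRe A) '' acceptingEffects r s) w := by
  obtain ⟨A, hA, p, hp, hmax, hmin⟩ := exists_forall_apply_le_dotProduct (diagRe (n := n))
    isCompact_acceptingEffects convex_acceptingEffects ⟨1, one_mem_acceptingEffects hr hs⟩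
  refine ⟨p ⬝ᵥ diagRe A, ⟨⟨A, hA, hmax⟩, ?_⟩, p, hp, Set.mem_image_of_mem _ hA, ?_⟩
  · rintro t ⟨B, hB, hBt⟩
    exact (hmin B hB).trans (forall_dotProduct_le_iff.mpr hBt p hp)
  · exact Set.forall_mem_image.mpr hmin

end Minimax

/-! ### Logarithms -/

section Logarithm

theorem elog_of_nonpos {x : EReal} (hx : x ≤ 0) : elog x = ⊥ :=
  if_pos hx

theorem elog_top : elog ⊤ = ⊤ := by
  rw [elog, if_neg (by simp), if_pos rfl]

theorem elog_coe_of_pos {x : ℝ} (hx : 0 < x) : elog x = Real.logb 2 x := by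
  rw [elog, if_neg (EReal.coe_pos.mpr hx).not_ge, if_neg (EReal.coe_ne_top x), EReal.toReal_coe]

theorem elog_mono : Monotone elog := by
  intro x y hxy
  rcases le_or_gt x 0 with hx | hx
  · exact elog_of_nonpos hx ▸ bot_le
  rcases eq_or_ne y ⊤ with rfl | hy
  · exact elog_top ▸ le_top
  lift x to ℝ using ⟨ne_top_of_le_ne_top hy hxy, (bot_le.trans_lt hx).ne'⟩
  lift y to ℝ using ⟨hy, ((bot_le.trans_lt hx).trans_le hxy).ne'⟩
  rw [EReal.coe_pos] at hx
  rw [EReal.coe_le_coe_iff] at hxy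
  rw [elog_coe_of_pos hx, elog_coe_of_pos (hx.trans_le hxy), EReal.coe_le_coe_iff]
  exact Real.logb_le_logb_of_le one_lt_two hx hxy

theorem logFloor_coe (x : ℝ) : logFloor x = elog ((⌊(2 : ℝ) ^ x⌋ : ℝ) : EReal) := by
  rw [logFloor, if_neg (EReal.coe_ne_bot x), if_neg (EReal.coe_ne_top x), EReal.toReal_coe]

theorem iSup_elog_natCast : ⨆ m ∈ {m : ℕ | 1 ≤ m}, elog ((m : ℝ) : EReal) = ⊤ := by
  refine EReal.eq_top_iff_forall_lt _ |>.mpr fun y => ?_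
  obtain ⟨m, hm⟩ := exists_nat_gt ((2 : ℝ) ^ y)
  have hm₀ : (0 : ℝ) < m := (Real.rpow_pos_of_pos two_pos y).trans hm
  refine lt_of_lt_of_le ?_ (le_iSup₂_of_le m (Nat.cast_pos.mp hm₀ : 1 ≤ m) le_rfl)
  rw [elog_coe_of_pos hm₀, EReal.coe_lt_coe_iff]
  exact (Real.lt_logb_iff_rpow_lt one_lt_two hm₀).mpr hm

theorem iSup_elog_natCast_eq_logFloor {w : ℝ} (hw₀ : 0 ≤ w) (hw₁ : w ≤ 1) :
    ⨆ m ∈ {m : ℕ | 1 ≤ m ∧ w ≤ 1 / m}, elog ((m : ℝ) : EReal) = logFloor (-elog w) := by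
  obtain rfl | hw := hw₀.eq_or_lt
  · rw [elog_of_nonpos EReal.coe_zero.le, EReal.neg_bot, logFloor, if_neg top_ne_bot, if_pos rfl,
      ← iSup_elog_natCast]
    simp only [one_div, inv_nonneg, Nat.cast_nonneg, and_true]
  · have hpow : (2 : ℝ) ^ (-Real.logb 2 w) = w⁻¹ := by
      rw [Real.rpow_neg two_pos.le, Real.rpow_logb two_pos (by norm_num) hw]
    have hmem {m : ℕ} (hm : 1 ≤ m) : w ≤ 1 / m ↔ m ≤ ⌊w⁻¹⌋₊ := by
      rw [Nat.le_floor_iff (inv_nonneg.mpr hw₀), one_div, le_inv_comm₀ hw (Nat.cast_pos.mpr hm)]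
    have hfloor : 1 ≤ ⌊w⁻¹⌋₊ := (Nat.one_le_floor_iff _).mpr ((one_le_inv₀ hw).mpr hw₁)
    rw [elog_coe_of_pos hw, ← EReal.coe_neg, logFloor_coe, hpow,
      ← natCast_floor_eq_intCast_floor (inv_nonneg.mpr hw₀)]
    refine (iSup₂_le fun m hm => elog_mono ?_).antisymm
      (le_iSup₂_of_le ⌊w⁻¹⌋₊ ⟨hfloor, (hmem hfloor).mpr le_rfl⟩ le_rfl)
    exact EReal.coe_le_coe_iff.mpr (Nat.cast_le.mpr ((hmem hm.1).mp hm.2))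

end Logarithm

/-! ### The one-shot distillable entanglement -/

section OneShot

variable {n : Type*} [Fintype n] {r : Matrix n n ℂ} {ε s w : ℝ}

theorem IsState.nonempty (hr : IsState r) : Nonempty n := by
  by_contra hn
  rw [not_nonempty_iff] at hn
  exact zero_ne_one ((trace_eq_zero_of_isEmpty r).symm.trans hr.2)

variable [DecidableEq n] {a b c : OrthonormalBasis n ℂ (EuclideanSpace ℂ n)}

theorem fidelity_maxCorr_eq_G (O : OpClass) (hr : IsState r) {m : ℕ} (hm : m ≠ 0) :
    fidelity O (maxCorr a b r) m = G m (incoherent c) (singleParty c r) := by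
  rw [fidelity_maxCorr a b O hr hm, singleParty_eq_inBasis,
    G_incoherent_inBasis (Nat.cast_pos.mpr hm.bot_lt)]

theorem distillable_maxCorr (O : OpClass) (hr : IsState r) (hε : 0 ≤ ε)
    (hw : IsLeast (diagLevels r (1 - ε)) w) :
    distillable O ε (maxCorr a b r) = logFloor (-elog w) := by
  have := hr.nonempty
  have hset : {m : ℕ | 1 ≤ m ∧ ((1 - ε : ℝ) : EReal) ≤ fidelity O (maxCorr a b r) m} =
      {m : ℕ | 1 ≤ m ∧ w ≤ 1 / m} := by
    ext m
    refine and_congr_right fun hm => ?_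
    rw [fidelity_maxCorr a b O hr (Nat.one_le_iff_ne_zero.mp hm),
      le_iSup_diagBoundedEffects_iff (by positivity), mem_diagLevels_iff hw]
  rw [distillable, hset, iSup_elog_natCast_eq_logFloor (nonneg_of_mem_diagLevels hw.1)
    (hw.2 (one_mem_diagLevels hr (by linarith)))]

theorem DH_inBasis_diagonal (p : n → ℝ) :
    DH ε (inBasis c r) (inBasis c (diagonal fun i => (p i : ℂ))) =
      -elog (⨅ A ∈ acceptingEffects r (1 - ε), ((p ⬝ᵥ diagRe A : ℝ) : EReal)) := by
  rw [DH]
  congr 2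
  refine ((EquivLike.surjective (inBasis c)).iInf_congr _ fun A => ?_).symm
  refine iInf_congr_Prop ?_ fun _ => by rw [hs_inBasis, hs_diagonal]
  rw [acceptingEffects, Set.mem_ofPred_eq, Set.mem_ofPred_eq, isEffect_inBasis_iff, hs_inBasis,
    hs_comm, sub_le_comm]

theorem isLeast_DH_image_incoherent (hw : w ∈ diagLevels r (1 - ε)) {p : n → ℝ}
    (hp : p ∈ stdSimplex ℝ n)
    (hpw : IsLeast ((fun A => p ⬝ᵥ diagRe A) '' acceptingEffects r (1 - ε)) w) :
    IsLeast (DH ε (singleParty c r) '' incoherent c) (-elog w) := by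
  rw [singleParty_eq_inBasis, incoherent_eq_image_stdSimplex, Set.image_image]
  simp only [DH_inBasis_diagonal]
  obtain ⟨A, hA, hAw⟩ := hw
  obtain ⟨⟨B, hB, hBw⟩, hmin⟩ := hpw
  refine ⟨⟨p, hp, congr_arg (-elog ·) (le_antisymm ?_ ?_)⟩, Set.forall_mem_image.mpr fun q hq => ?_⟩
  · exact iInf₂_le_of_le B hB (EReal.coe_le_coe_iff.mpr hBw.le)
  · exact le_iInf₂ fun C hC => EReal.coe_le_coe_iff.mpr (hmin (Set.mem_image_of_mem _ hC))
  · refine EReal.neg_le_neg_iff.mpr (elog_mono (iInf₂_le_of_le A hA ?_))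
    exact EReal.coe_le_coe_iff.mpr (forall_dotProduct_le_iff.mpr hAw q hq)

theorem exists_isEffect_le_hs_singleParty_iff {P : Matrix n n ℂ → Prop} :
    (∃ W, IsEffect W ∧ s ≤ hs (singleParty c r) W ∧ P W) ↔
      ∃ A ∈ acceptingEffects r s, P (inBasis c A) := by
  rw [(EquivLike.surjective (inBasis c)).exists]
  simp only [singleParty_eq_inBasis, hs_inBasis, isEffect_inBasis_iff, acceptingEffects,
    Set.mem_ofPred_eq, and_assoc]

theorem isLeast_opNorm_dephase [Nonempty n] (hw : IsLeast (diagLevels r s) w) :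
    IsLeast {t : ℝ | ∃ W : Matrix n n ℂ,
      IsEffect W ∧ s ≤ hs (singleParty c r) W ∧ t = opNorm (dephase c W)} w := by
  have hlower {A : Matrix n n ℂ} (hA : A ∈ acceptingEffects r s) :
      w ≤ opNorm (dephase c (inBasis c A)) :=
    hw.2 ⟨A, hA, (opNorm_dephase_inBasis_le_iff hA.1.1 (norm_nonneg _)).mp le_rfl⟩
  simp only [exists_isEffect_le_hs_singleParty_iff]
  obtain ⟨A, hA, hAw⟩ := hw.1
  refine ⟨⟨A, hA, (hlower hA).antisymm ?_⟩, fun t ⟨B, hB, ht⟩ => ht ▸ hlower hB⟩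
  exact (opNorm_dephase_inBasis_le_iff hA.1.1 (nonneg_of_mem_diagLevels hw.1)).mpr hAw

theorem setOf_posSemidef_smul_one_sub_dephase :
    {t : ℝ | ∃ W : Matrix n n ℂ, IsEffect W ∧ s ≤ hs (singleParty c r) W ∧
      ((t : ℂ) • (1 : Matrix n n ℂ) - dephase c W).PosSemidef} = diagLevels r s := by
  simp only [exists_isEffect_le_hs_singleParty_iff]
  exact Set.ext fun t => exists_congr fun A => and_congr_right fun hA =>
    posSemidef_smul_one_sub_dephase_inBasis_iff hA.1.1

end OneShot

end Distill

theorem mainTheorem5_general {n : Type*} [Fintype n] [DecidableEq n]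
    (a b c : OrthonormalBasis n ℂ (EuclideanSpace ℂ n)) (r : Matrix n n ℂ)
    (hρ : Distill.IsState (Distill.maxCorr a b r)) (O : Distill.OpClass) :
    (∀ m : ℕ, 1 ≤ m →
      Distill.fidelity O (Distill.maxCorr a b r) m =
        Distill.G (m : ℝ) (Distill.incoherent c) (Distill.singleParty c r)) ∧
    ∀ ε : ℝ, 0 ≤ ε →
      ∃ (v : EReal) (w : ℝ),
        IsLeast (Distill.DH ε (Distill.singleParty c r) '' Distill.incoherent c) v ∧
        IsLeast {t : ℝ | ∃ W : Matrix n n ℂ,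
          Distill.IsEffect W ∧ 1 - ε ≤ Distill.hs (Distill.singleParty c r) W ∧
            t = Distill.opNorm (Distill.dephase c W)} w ∧
        IsLeast {t : ℝ | ∃ W : Matrix n n ℂ,
          Distill.IsEffect W ∧ 1 - ε ≤ Distill.hs (Distill.singleParty c r) W ∧
            ((t : ℂ) • (1 : Matrix n n ℂ) - Distill.dephase c W).PosSemidef} w ∧
        Distill.distillable O ε (Distill.maxCorr a b r) = Distill.logFloor v ∧
        Distill.distillable O ε (Distill.maxCorr a b r) =
          Distill.logFloor (-Distill.elog ((w : ℝ) : EReal)) := by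
  have hr := hρ.of_maxCorr
  have := hr.nonempty
  refine ⟨fun m hm => Distill.fidelity_maxCorr_eq_G O hr (Nat.one_le_iff_ne_zero.mp hm),
    fun ε hε => ?_⟩
  obtain ⟨w, hw, p, hp, hpw⟩ := Distill.exists_isLeast_diagLevels hr (sub_le_self 1 hε)
  have hdistillable := Distill.distillable_maxCorr (a := a) (b := b) O hr hε hw
  exact ⟨_, w, Distill.isLeast_DH_image_incoherent hw.1 hp hpw,
    Distill.isLeast_opNorm_dephase hw,
    Distill.setOf_posSemidef_smul_one_sub_dephase (c := c) ▸ hw, hdistillable, hdistillable⟩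

theorem mainTheorem5 {d : ℕ}
    (a b c : OrthonormalBasis (Fin d) ℂ (EuclideanSpace ℂ (Fin d)))
    (r : Matrix (Fin d) (Fin d) ℂ) (hρ : Distill.IsState (Distill.maxCorr a b r))
    (O : Distill.OpClass) :
    (∀ m : ℕ, 1 ≤ m →
      Distill.fidelity O (Distill.maxCorr a b r) m =
        Distill.G (m : ℝ) (Distill.incoherent c) (Distill.singleParty c r)) ∧
    ∀ ε : ℝ, 0 ≤ ε → ε ≤ 1 →
      ∃ (v : EReal) (w : ℝ),
        IsLeast (Distill.DH ε (Distill.singleParty c r) '' Distill.incoherent c) v ∧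
        IsLeast {t : ℝ | ∃ W : Matrix (Fin d) (Fin d) ℂ,
          Distill.IsEffect W ∧ 1 - ε ≤ Distill.hs (Distill.singleParty c r) W ∧
            t = Distill.opNorm (Distill.dephase c W)} w ∧
        IsLeast {t : ℝ | ∃ W : Matrix (Fin d) (Fin d) ℂ,
          Distill.IsEffect W ∧ 1 - ε ≤ Distill.hs (Distill.singleParty c r) W ∧
            ((t : ℂ) • (1 : Matrix (Fin d) (Fin d) ℂ) - Distill.dephase c W).PosSemidef} w ∧
        Distill.distillable O ε (Distill.maxCorr a b r) = Distill.logFloor v ∧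
        Distill.distillable O ε (Distill.maxCorr a b r) =
          Distill.logFloor (-Distill.elog ((w : ℝ) : EReal)) :=
  ⟨(mainTheorem5_general a b c r hρ O).1,
    fun ε hε _ => (mainTheorem5_general a b c r hρ O).2 ε hε⟩
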